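/- Let $\mathcal M_n$ be the algebra of complex $n\times n$ matrices and $\mathcal M_{nm}=\mathcal M_n\otimes\mathcal M_m$. For $1\le t<\infty$ let $\|A\|_t=(\mathrm{Tr}\,|A|^t)^{1/t}$ with $|A|=(A^*A)^{1/2}$ be the Schatten norm, and let $\|A\|_\infty$ be the operator norm. For $p,q\in[1,\infty]$ define $r\in[1,\infty]$ by $\frac1r=\max\{\frac1p,\frac1q\}-\min\{\frac1p,\frac1q\}$ and, for $Y\in\mathcal M_{nm}$, define $\|Y\|_{NC}=\|Y\|_{NC:p,q}$ by $$\|Y\|_{NC}=\sup_{0\ne A,B\in\mathcal M_n}\frac{\|(A\otimes I_m)Y(B\otimes I_m)\|_p}{\|A\|_{2r}\|B\|_{2r}}\qquad(p\le q),$$ $$\|Y\|_{NC}=\inf\Big\{\sum_i\|A_i\|_{2r}\|B_i\|_{2r}\|Z_i\|_p\;:\;Y=\sum_i(A_i\otimes I_m)Z_i(B_i\otimes I_m)\Big\}\qquad(q\le p),$$ where the infimum is over all finite decompositions with $A_i,B_i\in\mathcal M_n$ and $Z_i\in\mathcal M_{nm}$. Let $p,q\in[1,\infty]$, and let $p',q'$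 be given by $\frac1{p'}=1-\frac1p$, $\frac1{q'}=1-\frac1q$. Then $\|\cdot\|_{NC}$ is well defined and finite (for $p=q$ the two expressions agree), and: (a) $\|Y+W\|_{NC}\le\|Y\|_{NC}+\|W\|_{NC}$ for all $Y,W\in\mathcal M_{nm}$. (b) $|\mathrm{Tr}(YW)|\le\|Y\|_{NC:p,q}\,\|W\|_{NC:p',q'}$ for all $Y,W\in\mathcal M_{nm}$. (c) $\|Y\|_{NC:p,q}=\sup\{|\mathrm{Tr}(YW)|:W\in\mathcal M_{nm},\ \|W\|_{NC:p',q'}\le1\}$ for all $Y\in\mathcal M_{nm}$. (d) $\|Y_1\otimes Y_2\|_{NC}=\|Y_1\|_q\,\|Y_2\|_p$ for all $Y_1\in\mathcal M_n$, $Y_2\in\mathcal M_m$. (e) If $p=q$, then $\|Y\|_{NC}=\|Y\|_p$ for all $Y\in\mathcal M_{nm}$ (for either defining expression). (f) Let $\{e_i\}$ and $\{f_j\}$ be orthonormal bases of $\mathbb C^n$ and $\mathbb C^m$, and let $Y\in\mathcal M_{nm}$ be diagonal in the basis $\{e_i\otimes f_j\}$ with diagonal entries $y_{ij}$. Then $\|Y\|_{NC}$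 is the classical mixed norm of $(y_{ij})$, that is, the $\ell^q$ norm over $i$ of the $\ell^p$ norms over $j$ of the rows; in particular, for $p,q<\infty$, $$\|Y\|_{NC}=\Big(\mathrm{Tr}_1\big(\mathrm{Tr}_2|Y|^p\big)^{q/p}\Big)^{1/q},$$ where $\mathrm{Tr}_1,\mathrm{Tr}_2$ denote the traces over the first and second tensor factor. -/

import Mathlib

open scoped ENNReal Kronecker MatrixOrder Matrix

noncomputable section

namespace NCNorm

/-- The Schatten norm `‖A‖_t` of a complex square matrix, for `t ∈ [1, ∞]`: it is
`(Tr |A|^t)^(1/t)` for finite `t`, where `|A| = (Aᴴ A)^(1/2)`, and the operator norm on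
Euclidean space for `t = ∞`. The trace of the positive semidefinite matrix `|A|^t` is real. -/
def schatten {ι : Type*} [Fintype ι] [DecidableEq ι] (t : ℝ≥0∞) (A : Matrix ι ι ℂ) : ℝ :=
  if t = ∞ then ‖Matrix.toEuclideanCLM (n := ι) (𝕜 := ℂ) A‖
  else (Matrix.trace ((CFC.abs A) ^ t.toReal)).re ^ (1 / t.toReal)

/-- The exponent `r ∈ [1, ∞]` with `1/r = max (1/p) (1/q) - min (1/p) (1/q)`. -/
def rExp (p q : ℝ≥0∞) : ℝ≥0∞ :=
  (max p⁻¹ q⁻¹ - min p⁻¹ q⁻¹)⁻¹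

/-- `A ⊗ I_m`, acting on the first (outside) factor. -/
def ampl {n : ℕ} (m : ℕ) (A : Matrix (Fin n) (Fin n) ℂ) :
    Matrix (Fin n × Fin m) (Fin n × Fin m) ℂ :=
  A ⊗ₖ (1 : Matrix (Fin m) (Fin m) ℂ)

/-- The set of quotients `‖(A ⊗ I) Y (B ⊗ I)‖_p / (‖A‖_{2r} ‖B‖_{2r})`, `A, B ≠ 0`. -/
def supSet {n m : ℕ} (p q : ℝ≥0∞) (Y : Matrix (Fin n × Fin m) (Fin n × Fin m) ℂ) : Set ℝ :=
  {x | ∃ A B : Matrix (Fin n) (Fin n) ℂ, A ≠ 0 ∧ B ≠ 0 ∧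
    x = schatten p (ampl m A * Y * ampl m B) /
      (schatten (2 * rExp p q) A * schatten (2 * rExp p q) B)}

/-- The set of values `∑ i, ‖A_i‖_{2r} ‖B_i‖_{2r} ‖Z_i‖_p` over all finite decompositions
`Y = ∑ i, (A_i ⊗ I) Z_i (B_i ⊗ I)`. -/
def infSet {n m : ℕ} (p q : ℝ≥0∞) (Y : Matrix (Fin n × Fin m) (Fin n × Fin m) ℂ) : Set ℝ :=
  {x | ∃ (k : ℕ) (A B : Fin k → Matrix (Fin n) (Fin n) ℂ)
    (Z : Fin k → Matrix (Fin n × Fin m) (Fin n × Fin m) ℂ),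
    Y = ∑ i, ampl m (A i) * Z i * ampl m (B i) ∧
    x = ∑ i, schatten (2 * rExp p q) (A i) * schatten (2 * rExp p q) (B i) * schatten p (Z i)}

/-- The supremum expression, used for `p ≤ q`. -/
def ncSup {n m : ℕ} (p q : ℝ≥0∞) (Y : Matrix (Fin n × Fin m) (Fin n × Fin m) ℂ) : ℝ :=
  sSup (supSet p q Y)

/-- The infimum expression, used for `q ≤ p`. -/
def ncInf {n m : ℕ} (p q : ℝ≥0∞) (Y : Matrix (Fin n × Fin m) (Fin n × Fin m) ℂ) : ℝ :=
  sInf (infSet p q Y)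

open Classical in
/-- The Pisier-type norm `‖Y‖_{NC:p,q}`. For `p = q` both expressions are meant to apply; the
definition takes the supremum there. -/
def ncNorm {n m : ℕ} (p q : ℝ≥0∞) (Y : Matrix (Fin n × Fin m) (Fin n × Fin m) ℂ) : ℝ :=
  if p ≤ q then ncSup p q Y else ncInf p q Y

/-- The partial trace over the second (inside) factor. -/
def partialTrace₂ {n m : ℕ} (Y : Matrix (Fin n × Fin m) (Fin n × Fin m) ℂ) :
    Matrix (Fin n) (Fin n) ℂ :=
  Matrix.of fun i i' => ∑ j, Y (i, j) (i', j)

/-- The quantity `(Tr₁ (Tr₂ |Y|^p)^(q/p))^(1/q)` for finite `p` and `q`. -/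
def tracePQ {n m : ℕ} (p q : ℝ) (Y : Matrix (Fin n × Fin m) (Fin n × Fin m) ℂ) : ℝ :=
  (Matrix.trace ((partialTrace₂ ((CFC.abs Y) ^ p)) ^ (q / p))).re ^ (1 / q)

/-- The classical `ℓ^q(ℓ^p)` norm of an array, `p, q ∈ [1, ∞]`. -/
def mixedNorm {n m : ℕ} (p q : ℝ≥0∞) (y : Fin n → Fin m → ℂ) : ℝ :=
  ‖WithLp.toLp q fun i => ‖WithLp.toLp p (y i)‖‖

/-- `Y` is diagonal in the product basis `e_i ⊗ f_j`, with diagonal entries `y i j`. -/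
def IsDiagIn {n m : ℕ} (e : OrthonormalBasis (Fin n) ℂ (EuclideanSpace ℂ (Fin n)))
    (f : OrthonormalBasis (Fin m) ℂ (EuclideanSpace ℂ (Fin m)))
    (Y : Matrix (Fin n × Fin m) (Fin n × Fin m) ℂ) (y : Fin n → Fin m → ℂ) : Prop :=
  ∀ i j, Y *ᵥ (fun k : Fin n × Fin m => e i k.1 * f j k.2) =
    y i j • (fun k : Fin n × Fin m => e i k.1 * f j k.2)

end NCNorm

end

/-!
The Schatten norm of `U diag(d) V`, with `U` and `V` unitary, is the `ℓ^t` norm of `d`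
(`schatten_mul_diagonal_mul`), so a singular value decomposition (`exists_svd`) reduces the theory
of these norms to finite sequences. Hölder's inequality for the trace pairing (`norm_trace_mul_le`)
is then the classical one with doubly stochastic weights; it is attained, which yields the triangle
inequality. The two deeper facts come from the three lines theorem: the Hölder inequality
`‖A B‖_c ≤ ‖A‖_a ‖B‖_b` for `1/c = 1/a + 1/b` (`schatten_mul_le`), and the bound
`‖(A ⊗ 1) diag(w)‖_t ≤ ‖A‖_t` for `t ≥ 2`, valid when every row of `w` has `ℓ^t` norm at most `1`
(`schatten_kronecker_one_mul_diagonal_le`).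

For conjugate exponents the supremum and infimum expressions are dual to each other under the trace
pairing. The pairing inequality follows from the definitions and Schatten duality. The supremum
expression is the dual norm of the infimum expression because `(B ⊗ 1) Z (A ⊗ 1)` is a one-term
decomposition; the converse is the Hahn–Banach theorem in finite dimension
(`exists_ncSup_le_one_ncInf_le`). Both expressions give the Schatten norm at `p = q`, so they may be
used interchangeably there, and the norm with `p ≤ q` is always paired with an infimum.

For product matrices and for matrices that are diagonal in a product basis it is therefore enough
to bound the norm from *above* by the expected value, for all `p` and `q`: applied to the conjugate
exponents, this bound and the classical optimiser in Hölder's inequality give the lower bound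
(`le_ncNorm_of_trace`). For `q < p` the upper bound is an explicit factorisation into powers. For
`p ≤ q` and product matrices it is the Hölder inequality; for a diagonal `Y` with row norms `c i`
one writes `Y = (C ⊗ 1) W₁ W₂ (C ⊗ 1)`, with `C = diag(√c)` and diagonal `W₁`, `W₂` whose rows have
`ℓ^(2p)` norm at most `1`, and uses both interpolation results.
-/

namespace NCNorm

/-! ### Functional calculus of unitarily diagonalised matrices -/

/-- Conjugation of diagonal matrices by the unitary `U`, as a star homomorphism. -/
noncomputable def conjDiag {ι : Type*} [Fintype ι] [DecidableEq ι]
    (U : Matrix.unitaryGroup ι ℂ) : (ι → ℂ) →⋆ₐ[ℂ] Matrix ι ι ℂ :=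
  ((Unitary.conjStarAlgAut ℂ (Matrix ι ι ℂ) U : Matrix ι ι ℂ ≃⋆ₐ[ℂ] Matrix ι ι ℂ) :
    Matrix ι ι ℂ →⋆ₐ[ℂ] Matrix ι ι ℂ).comp
  { Matrix.diagonalAlgHom ℂ with
    map_star' := fun d => by
      simp [Matrix.star_eq_conjTranspose, Matrix.diagonal_conjTranspose] }

lemma conjDiag_apply {ι : Type*} [Fintype ι] [DecidableEq ι] (U : Matrix.unitaryGroup ι ℂ)
    (d : ι → ℂ) :
    conjDiag U d = (U : Matrix ι ι ℂ) * Matrix.diagonal d * star (U : Matrix ι ι ℂ) := by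
  simp [conjDiag]

lemma conjDiag_ofReal_nonneg {ι : Type*} [Fintype ι] [DecidableEq ι] (U : Matrix.unitaryGroup ι ℂ)
    (s : ι → ℝ) (hs : ∀ i, 0 ≤ s i) : 0 ≤ conjDiag U (fun i => (s i : ℂ)) := by
  have h : (fun i => (s i : ℂ)) =
      star (fun i => ((√(s i) : ℝ) : ℂ)) * (fun i => ((√(s i) : ℝ) : ℂ)) := by
    funext i
    simp only [Pi.mul_apply, Pi.star_apply, RCLike.star_def, Complex.conj_ofReal]
    rw [← Complex.ofReal_mul, Real.mul_self_sqrt (hs i)]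
  rw [h, map_mul, map_star]
  exact star_mul_self_nonneg _

/-- On unitarily diagonalised positive semidefinite matrices the functional calculus `A ^ y` acts
entrywise on the eigenvalues. -/
lemma conjDiag_rpow {ι : Type*} [Fintype ι] [DecidableEq ι] (U : Matrix.unitaryGroup ι ℂ)
    (s : ι → ℝ) (hs : ∀ i, 0 ≤ s i) (y : ℝ) :
    (conjDiag U (fun i => (s i : ℂ))) ^ y = conjDiag U (fun i => ((s i ^ y : ℝ) : ℂ)) := by
  have hsa : IsSelfAdjoint (fun i => (s i : ℂ)) := by
    rw [IsSelfAdjoint]; funext i; simp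
  -- on the finite spectrum the power agrees with an interpolating polynomial
  set P : Polynomial ℝ := Lagrange.interpolate (Finset.univ.image s) id (fun x => x ^ y) with hP
  have hPs : ∀ i, P.eval (s i) = s i ^ y := fun i =>
    Lagrange.eval_interpolate_at_node (v := id) _ (Set.injOn_id _)
      (Finset.mem_image_of_mem s (Finset.mem_univ i))
  have hspec : spectrum ℝ (conjDiag U (fun i => (s i : ℂ))) ⊆ Set.range s := by
    refine (AlgHom.spectrum_apply_subset ((conjDiag U).toAlgHom.restrictScalars ℝ) _).trans ?_
    rw [Pi.spectrum_eq]
    refine Set.iUnion_subset fun i => ?_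
    rw [← Complex.coe_algebraMap, spectrum.scalar_eq]
    exact Set.singleton_subset_iff.2 ⟨i, rfl⟩
  rw [CFC.rpow_eq_cfc_real (conjDiag_ofReal_nonneg U s hs),
    cfc_congr (g := P.eval) fun x hx => by
      obtain ⟨i, rfl⟩ := hspec hx
      exact (hPs i).symm,
    cfc_polynomial P _ (hsa.map _)]
  have h1 := Polynomial.aeval_algHom_apply ((conjDiag U).toAlgHom.restrictScalars ℝ)
    (fun i => (s i : ℂ)) P
  refine h1.trans ?_
  change conjDiag U _ = _
  congr 1
  funext i
  rw [← hPs i]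
  have h2 := Polynomial.aeval_algHom_apply (Pi.evalAlgHom ℝ (fun _ : ι => ℂ) i)
    (fun i => (s i : ℂ)) P
  refine h2.symm.trans ?_
  exact Polynomial.aeval_algebraMap_apply ℂ (s i) P

lemma trace_conjDiag {ι : Type*} [Fintype ι] [DecidableEq ι] (U : Matrix.unitaryGroup ι ℂ)
    (d : ι → ℂ) : (conjDiag U d).trace = ∑ i, d i := by
  rw [conjDiag_apply, Matrix.trace_mul_cycle, Unitary.coe_star_mul_self, one_mul,
    Matrix.trace_diagonal]

lemma abs_mul_diagonal_mul {ι : Type*} [Fintype ι] [DecidableEq ι]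
    (U V : Matrix.unitaryGroup ι ℂ) (d : ι → ℂ) :
    CFC.abs ((U : Matrix ι ι ℂ) * Matrix.diagonal d * (V : Matrix ι ι ℂ)) =
      conjDiag (star V) (fun i => ((‖d i‖ : ℝ) : ℂ)) := by
  refine CFC.sqrt_unique ?_ (conjDiag_ofReal_nonneg _ _ fun _ => norm_nonneg _)
  rw [← map_mul, conjDiag_apply]
  have h : (fun i => ((‖d i‖ : ℝ) : ℂ)) * (fun i => ((‖d i‖ : ℝ) : ℂ)) = star d * d := by
    funext i
    simp only [Pi.mul_apply, Pi.star_apply, RCLike.star_def]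
    rw [← Complex.normSq_eq_conj_mul_self, Complex.normSq_eq_norm_sq]
    push_cast; ring
  have h2 : star (Matrix.diagonal d) * Matrix.diagonal d = Matrix.diagonal (star d * d) := by
    rw [Matrix.star_eq_conjTranspose, Matrix.diagonal_conjTranspose, Matrix.diagonal_mul_diagonal]
    rfl
  rw [h, ← h2]
  simp only [star_mul, Unitary.coe_star, star_star, mul_assoc]
  rw [← mul_assoc (star (U : Matrix ι ι ℂ)) (U : Matrix ι ι ℂ), Unitary.coe_star_mul_self, one_mul]

/-! ### Schatten norms and singular value decompositions -/

/-- The `ℓ^t` norm of a finite family of reals. -/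
noncomputable def lpn {ι : Type*} [Fintype ι] (t : ℝ≥0∞) (s : ι → ℝ) : ℝ := ‖WithLp.toLp t s‖

lemma lpn_top {ι : Type*} [Fintype ι] (s : ι → ℝ) : lpn ∞ s = ‖s‖ := by
  rw [lpn, PiLp.norm_toLp]

lemma lpn_of_ne_top {ι : Type*} [Fintype ι] {t : ℝ≥0∞} (h1 : 1 ≤ t) (ht : t ≠ ∞) (s : ι → ℝ) :
    lpn t s = (∑ i, |s i| ^ t.toReal) ^ (1 / t.toReal) := by
  rw [lpn, PiLp.norm_eq_sum (ENNReal.toReal_pos (by positivity) ht)]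
  simp

lemma schatten_mul_diagonal_mul {ι : Type*} [Fintype ι] [DecidableEq ι] {t : ℝ≥0∞} (h1 : 1 ≤ t)
    (U V : Matrix.unitaryGroup ι ℂ) (d : ι → ℂ) :
    schatten t ((U : Matrix ι ι ℂ) * Matrix.diagonal d * (V : Matrix ι ι ℂ)) =
      lpn t (fun i => ‖d i‖) := by
  rw [schatten]
  split_ifs with ht
  · subst ht
    rw [lpn_top]
    have : ‖Matrix.toEuclideanCLM (n := ι) (𝕜 := ℂ) (Matrix.diagonal d)‖ = ‖d‖ :=
      open scoped Matrix.Norms.L2Operator in Matrix.l2_opNorm_diagonal d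
    rw [map_mul, map_mul]
    have hu : ∀ W : Matrix.unitaryGroup ι ℂ,
        Matrix.toEuclideanCLM (n := ι) (𝕜 := ℂ) (W : Matrix ι ι ℂ) ∈ unitary _ := fun W =>
      Unitary.map_mem _ W.2
    rw [CStarRing.norm_mul_mem_unitary _ (hu V), CStarRing.norm_mem_unitary_mul _ (hu U), this]
    simp [Pi.norm_def]
  · rw [lpn_of_ne_top h1 ht, abs_mul_diagonal_mul, conjDiag_rpow _ _ (fun _ => norm_nonneg _),
      trace_conjDiag, ← Complex.ofReal_sum, Complex.ofReal_re]
    simp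

/-- The singular value decomposition. The right unitary diagonalises `Aᴴ A`; the normalised images
of its columns form an orthonormal family, which is completed to a basis. -/
lemma exists_svd {ι : Type*} [Fintype ι] [DecidableEq ι] (A : Matrix ι ι ℂ) :
    ∃ (U V : Matrix.unitaryGroup ι ℂ) (s : ι → ℝ), (∀ i, 0 ≤ s i) ∧
      A = (U : Matrix ι ι ℂ) * Matrix.diagonal (fun i => (s i : ℂ)) * (V : Matrix ι ι ℂ) := by
  have hH : (Aᴴ * A).IsHermitian := Matrix.isHermitian_conjTranspose_mul_self A
  have hP : open scoped ComplexOrder in (Aᴴ * A).PosSemidef :=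
    open scoped ComplexOrder in Matrix.posSemidef_conjTranspose_mul_self A
  set V := hH.eigenvectorUnitary with hV
  set s : ι → ℝ := fun i => √(hH.eigenvalues i) with hs
  have hs0 : ∀ i, 0 ≤ s i := fun i => Real.sqrt_nonneg _
  set B : Matrix ι ι ℂ := A * (V : Matrix ι ι ℂ) with hB
  have hBB : Bᴴ * B = Matrix.diagonal (fun i => ((s i : ℂ)) ^ 2) := by
    have h1 := hH.spectral_theorem
    rw [Unitary.conjStarAlgAut_apply] at h1
    have h2 : Bᴴ * B = star (V : Matrix ι ι ℂ) * (Aᴴ * A) * (V : Matrix ι ι ℂ) := by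
      rw [hB, Matrix.conjTranspose_mul, Matrix.star_eq_conjTranspose]
      simp only [mul_assoc]
    rw [h2, h1]
    simp only [← mul_assoc]
    rw [Unitary.coe_star_mul_self, one_mul, mul_assoc, Unitary.coe_star_mul_self, mul_one]
    congr 1
    funext i
    simp only [Function.comp, hs]
    rw [← Complex.ofReal_pow, Real.sq_sqrt (hP.eigenvalues_nonneg i)]
    rfl
  -- the normalised columns of `A V` with non-zero singular value are orthonormal
  let v : ι → EuclideanSpace ℂ ι := fun i => WithLp.toLp 2 fun k => ((s i : ℂ))⁻¹ * B k i
  have hv : Orthonormal ℂ (({i | s i ≠ 0} : Set ι).domRestrict v) := by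
    rw [orthonormal_iff_ite]
    rintro ⟨i, hi⟩ ⟨j, hj⟩
    have hi' : (s i : ℂ) ≠ 0 := by exact_mod_cast hi
    have hj' : (s j : ℂ) ≠ 0 := by exact_mod_cast hj
    have hij : ∑ k, star (B k i) * B k j = if i = j then ((s i : ℂ)) ^ 2 else 0 := by
      have := congrFun (congrFun hBB i) j
      rw [Matrix.diagonal_apply, Matrix.mul_apply] at this
      exact this
    have e1 : inner ℂ (v i) (v j) = ((s i : ℂ))⁻¹ * ((s j : ℂ))⁻¹ * ∑ k, star (B k i) * B k j := by
      rw [PiLp.inner_apply, Finset.mul_sum]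
      refine Finset.sum_congr rfl fun k _ => ?_
      simp [v]
      ring
    change inner ℂ (v i) (v j) = _
    rw [e1, hij]
    by_cases h : i = j
    · subst h; simp; field_simp
    · simp [h]
  obtain ⟨b, hb⟩ := hv.exists_orthonormalBasis_extension_of_card_eq (by simp)
  let W : Matrix ι ι ℂ := Matrix.of fun k i => b i k
  have hW : W ∈ Matrix.unitaryGroup ι ℂ := by
    rw [Matrix.mem_unitaryGroup_iff']
    ext i j
    have := (orthonormal_iff_ite.1 b.orthonormal) i j
    rw [PiLp.inner_apply] at this
    rw [Matrix.mul_apply, Matrix.one_apply, ← this]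
    refine Finset.sum_congr rfl fun k _ => ?_
    simp [W, Matrix.star_apply, mul_comm]
  have hBW : B = W * Matrix.diagonal (fun i => (s i : ℂ)) := by
    ext k i
    rw [Matrix.mul_diagonal]
    -- a column of `A V` with zero singular value vanishes
    by_cases h : s i = 0
    · have h0 : ∑ k, star (B k i) * B k i = 0 := by
        have := congrFun (congrFun hBB i) i
        rw [Matrix.diagonal_apply, Matrix.mul_apply] at this
        simpa [h] using this
      have h1 : ∑ k, ‖B k i‖ ^ 2 = 0 := by
        have : ((∑ k, ‖B k i‖ ^ 2 : ℝ) : ℂ) = 0 := by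
          rw [← h0]; push_cast
          refine Finset.sum_congr rfl fun k _ => ?_
          rw [RCLike.star_def, ← Complex.normSq_eq_conj_mul_self, Complex.normSq_eq_norm_sq]
          push_cast; rfl
        exact_mod_cast this
      have h2 := (Finset.sum_eq_zero_iff_of_nonneg (fun k _ => by positivity)).1 h1 k
        (Finset.mem_univ _)
      have h3 : B k i = 0 := by simpa using h2
      simp [h, h3]
    · have h' : (s i : ℂ) ≠ 0 := by exact_mod_cast h
      have : b i k = ((s i : ℂ))⁻¹ * B k i := by rw [hb i h]
      simp only [W, Matrix.of_apply, this]
      field_simp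
  refine ⟨⟨W, hW⟩, star V, s, hs0, ?_⟩
  change A = W * _ * star (V : Matrix ι ι ℂ)
  rw [← hBW, hB, mul_assoc, Unitary.mul_star_self_of_mem V.2, mul_one]

/-! ### Finite sequences -/

section LpNorm
variable {ι κ : Type*} [Fintype ι] [Fintype κ] {t : ℝ≥0∞}

lemma one_le_toReal {t : ℝ≥0∞} (h1 : 1 ≤ t) (ht : t ≠ ∞) : 1 ≤ t.toReal := by
  have := ENNReal.toReal_mono ht h1
  simpa using this

lemma toReal_inv_add_toReal_inv {p p' : ℝ≥0∞} (h : p⁻¹ + p'⁻¹ = 1) :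
    p.toReal⁻¹ + p'.toReal⁻¹ = 1 := by
  have h1 : p⁻¹ ≠ ∞ := ((le_self_add.trans h.le).trans_lt ENNReal.one_lt_top).ne
  have h2 : p'⁻¹ ≠ ∞ := ((le_add_self.trans h.le).trans_lt ENNReal.one_lt_top).ne
  rw [← ENNReal.toReal_inv, ← ENNReal.toReal_inv, ← ENNReal.toReal_add h1 h2, h,
    ENNReal.toReal_one]

lemma lpn_nonneg (h1 : 1 ≤ t) (s : ι → ℝ) : 0 ≤ lpn t s :=
  have : Fact (1 ≤ t) := ⟨h1⟩
  norm_nonneg (WithLp.toLp t s)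

lemma lpn_zero (h1 : 1 ≤ t) : lpn t (0 : ι → ℝ) = 0 :=
  have : Fact (1 ≤ t) := ⟨h1⟩
  norm_zero (E := PiLp t fun _ : ι => ℝ)

lemma eq_zero_of_lpn (h1 : 1 ≤ t) {s : ι → ℝ} (h : lpn t s = 0) : s = 0 := by
  have : Fact (1 ≤ t) := ⟨h1⟩
  have := norm_eq_zero.1 (show ‖WithLp.toLp t s‖ = 0 from h)
  exact (WithLp.toLp_eq_zero t).1 this

lemma lpn_const_mul (h1 : 1 ≤ t) (c : ℝ) (s : ι → ℝ) :
    lpn t (fun i => c * s i) = |c| * lpn t s := by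
  have : Fact (1 ≤ t) := ⟨h1⟩
  exact norm_smul c (WithLp.toLp t s)

lemma lpn_mono (h1 : 1 ≤ t) {s u : ι → ℝ} (h : ∀ i, |s i| ≤ |u i|) : lpn t s ≤ lpn t u := by
  by_cases ht : t = ∞
  · subst ht
    rw [lpn_top, lpn_top]
    exact (pi_norm_le_iff_of_nonneg (norm_nonneg _)).2 fun i =>
      (h i).trans (norm_le_pi_norm u i)
  · rw [lpn_of_ne_top h1 ht, lpn_of_ne_top h1 ht]
    refine Real.rpow_le_rpow (by positivity) (Finset.sum_le_sum fun i _ => ?_) (by positivity)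
    exact Real.rpow_le_rpow (abs_nonneg _) (h i) (by positivity)

lemma lpn_abs (h1 : 1 ≤ t) (s : ι → ℝ) : lpn t (fun i => |s i|) = lpn t s :=
  le_antisymm (lpn_mono h1 fun i => by simp) (lpn_mono h1 fun i => by simp)

lemma abs_le_lpn (h1 : 1 ≤ t) (s : ι → ℝ) (i : ι) : |s i| ≤ lpn t s :=
  have : Fact (1 ≤ t) := ⟨h1⟩
  PiLp.norm_apply_le (WithLp.toLp t s) i

lemma lpn_top_le {s : ι → ℝ} {C : ℝ} (hC : 0 ≤ C) (h : ∀ i, |s i| ≤ C) : lpn ∞ s ≤ C := by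
  rw [lpn_top]
  exact (pi_norm_le_iff_of_nonneg hC).2 h

lemma lpn_top_le_lpn (h1 : 1 ≤ t) (s : ι → ℝ) : lpn ∞ s ≤ lpn t s :=
  lpn_top_le (lpn_nonneg h1 s) (abs_le_lpn h1 s)

lemma rpow_lpn_toReal (h1 : 1 ≤ t) (ht : t ≠ ∞) (s : ι → ℝ) :
    lpn t s ^ t.toReal = ∑ i, |s i| ^ t.toReal := by
  have := one_le_toReal h1 ht
  rw [lpn_of_ne_top h1 ht, ← Real.rpow_mul (by positivity), one_div_mul_cancel (by positivity),
    Real.rpow_one]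

/-- The family `s ^ (q / c)` has `ℓ^c` norm at most `‖s‖_q ^ (q / c)`; for `c = ∞` the exponent
is `0`, and the convention `0 ^ 0 = 1` is harmless. -/
lemma lpn_rpow_le {q c : ℝ≥0∞} (hq : 1 ≤ q) (hq' : q ≠ ∞) (hc : 1 ≤ c) {s : ι → ℝ}
    (hs : ∀ i, 0 ≤ s i) :
    lpn c (fun i => s i ^ (q.toReal * c⁻¹.toReal)) ≤ lpn q s ^ (q.toReal * c⁻¹.toReal) := by
  by_cases hc' : c = ∞
  · subst hc'
    exact lpn_top_le (Real.rpow_nonneg (lpn_nonneg hq s) _) fun i => by simp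
  · have h1 := one_le_toReal hq hq'
    have h2 := one_le_toReal hc hc'
    rw [lpn_of_ne_top hc hc', lpn_of_ne_top hq hq', ← Real.rpow_mul (by positivity),
      ENNReal.toReal_inv]
    refine le_of_eq ?_
    have e : ∀ i, |s i ^ (q.toReal * c.toReal⁻¹)| ^ c.toReal = |s i| ^ q.toReal := fun i => by
      rw [abs_of_nonneg (Real.rpow_nonneg (hs i) _), abs_of_nonneg (hs i),
        ← Real.rpow_mul (hs i)]
      congr 1; field_simp
    simp only [e]
    congr 1; field_simp

lemma sum_mul_mul_le_lpn_one_mul_lpn_top (s : ι → ℝ) (u : κ → ℝ) (m : ι → κ → ℝ)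
    (hs : ∀ i, 0 ≤ s i) (hm : ∀ i j, 0 ≤ m i j) (hr : ∀ i, ∑ j, m i j ≤ 1) :
    ∑ i, ∑ j, s i * u j * m i j ≤ lpn 1 s * lpn ∞ u := by
  rw [lpn_of_ne_top le_rfl ENNReal.one_ne_top]
  simp only [ENNReal.toReal_one, Real.rpow_one, one_div, inv_one]
  rw [Finset.sum_mul]
  refine Finset.sum_le_sum fun i _ => ?_
  rw [abs_of_nonneg (hs i)]
  have hU := lpn_nonneg (t := ∞) le_top u
  calc ∑ j, s i * u j * m i j ≤ ∑ j, s i * lpn ∞ u * m i j := by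
        refine Finset.sum_le_sum fun j _ => ?_
        have := (le_abs_self _).trans (abs_le_lpn (t := ∞) le_top u j)
        have := hs i; have := hm i j
        gcongr
    _ = s i * lpn ∞ u * ∑ j, m i j := by rw [Finset.mul_sum]
    _ ≤ s i * lpn ∞ u * 1 := by
        have := hs i
        gcongr
        exact hr i
    _ = _ := mul_one _

/-- Hölder's inequality for a sum weighted by a matrix with row and column sums at most `1`. -/
lemma sum_mul_mul_le_lpn_mul_lpn {p p' : ℝ≥0∞} (hp : 1 ≤ p) (h : p⁻¹ + p'⁻¹ = 1)
    (s : ι → ℝ) (u : κ → ℝ) (m : ι → κ → ℝ) (hs : ∀ i, 0 ≤ s i) (hu : ∀ j, 0 ≤ u j)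
    (hm : ∀ i j, 0 ≤ m i j) (hr : ∀ i, ∑ j, m i j ≤ 1) (hc : ∀ j, ∑ i, m i j ≤ 1) :
    ∑ i, ∑ j, s i * u j * m i j ≤ lpn p s * lpn p' u := by
  by_cases hpt : p = ∞
  · subst hpt
    have : p' = 1 := by simpa using h
    subst this
    rw [mul_comm, Finset.sum_comm]
    refine le_trans (le_of_eq ?_)
      (sum_mul_mul_le_lpn_one_mul_lpn_top u s (fun j i => m i j) hu (fun j i => hm i j) hc)
    exact Finset.sum_congr rfl fun i _ => Finset.sum_congr rfl fun j _ => by ring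
  by_cases hpt' : p' = ∞
  · subst hpt'
    have : p = 1 := by simpa using h
    subst this
    exact sum_mul_mul_le_lpn_one_mul_lpn_top s u m hs hm hr
  have hp' : 1 ≤ p' := by
    rw [← ENNReal.inv_le_one, ← h]; exact le_add_self
  have h1 := one_le_toReal hp hpt
  have h2 := one_le_toReal hp' hpt'
  have hreal := toReal_inv_add_toReal_inv h
  set a := p.toReal
  set b := p'.toReal
  have hab : a.HolderConjugate b := by
    rw [Real.holderConjugate_iff]
    refine ⟨?_, hreal⟩
    rcases h1.lt_or_eq with h | h
    · exact h
    · rw [← h] at hreal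
      have : b⁻¹ = 0 := by linarith
      have : 0 < b⁻¹ := by positivity
      linarith
  have ha := hab.pos
  have hb := hab.symm.pos
  -- the weight is split between the two factors as `m = m ^ (1/a) * m ^ (1/b)`
  have H := Real.inner_le_Lp_mul_Lq (Finset.univ : Finset (ι × κ))
    (fun x => s x.1 * m x.1 x.2 ^ (a⁻¹)) (fun x => u x.2 * m x.1 x.2 ^ (b⁻¹)) hab
  have e1 : ∑ x : ι × κ, (s x.1 * m x.1 x.2 ^ (a⁻¹)) * (u x.2 * m x.1 x.2 ^ (b⁻¹)) =
      ∑ i, ∑ j, s i * u j * m i j := by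
    rw [Fintype.sum_prod_type]
    refine Finset.sum_congr rfl fun i _ => Finset.sum_congr rfl fun j _ => ?_
    have : m i j ^ (a⁻¹) * m i j ^ (b⁻¹) = m i j := by
      rw [← Real.rpow_add_of_nonneg (hm i j) (by positivity) (by positivity), hreal, Real.rpow_one]
    calc _ = s i * u j * (m i j ^ (a⁻¹) * m i j ^ (b⁻¹)) := by ring
      _ = _ := by rw [this]
  rw [e1] at H
  refine H.trans ?_
  rw [lpn_of_ne_top hp hpt, lpn_of_ne_top hp' hpt']
  have e2 : ∑ x : ι × κ, |s x.1 * m x.1 x.2 ^ (a⁻¹)| ^ a ≤ ∑ i, |s i| ^ a := by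
    rw [Fintype.sum_prod_type]
    refine Finset.sum_le_sum fun i _ => ?_
    calc ∑ j, |s i * m i j ^ (a⁻¹)| ^ a = |s i| ^ a * ∑ j, m i j := by
          rw [Finset.mul_sum]
          refine Finset.sum_congr rfl fun j _ => ?_
          rw [abs_mul, Real.mul_rpow (abs_nonneg _) (abs_nonneg _),
            abs_of_nonneg (Real.rpow_nonneg (hm i j) _), ← Real.rpow_mul (hm i j),
            inv_mul_cancel₀ ha.ne', Real.rpow_one]
      _ ≤ |s i| ^ a * 1 := by gcongr; exact hr i
      _ = _ := mul_one _
  have e3 : ∑ x : ι × κ, |u x.2 * m x.1 x.2 ^ (b⁻¹)| ^ b ≤ ∑ i, |u i| ^ b := by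
    rw [Fintype.sum_prod_type_right]
    refine Finset.sum_le_sum fun j _ => ?_
    calc ∑ i, |u j * m i j ^ (b⁻¹)| ^ b = |u j| ^ b * ∑ i, m i j := by
          rw [Finset.mul_sum]
          refine Finset.sum_congr rfl fun i _ => ?_
          rw [abs_mul, Real.mul_rpow (abs_nonneg _) (abs_nonneg _),
            abs_of_nonneg (Real.rpow_nonneg (hm i j) _), ← Real.rpow_mul (hm i j),
            inv_mul_cancel₀ hb.ne', Real.rpow_one]
      _ ≤ |u j| ^ b * 1 := by gcongr; exact hc j
      _ = _ := mul_one _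
  gcongr

/-- Hölder's inequality for the `ℓ^p` norms is attained. -/
lemma exists_sum_mul_eq_lpn {p p' : ℝ≥0∞} (hp : 1 ≤ p) (h : p⁻¹ + p'⁻¹ = 1)
    (s : ι → ℝ) (hs : ∀ i, 0 ≤ s i) :
    ∃ u : ι → ℝ, (∀ i, 0 ≤ u i) ∧ lpn p' u ≤ 1 ∧ ∑ i, s i * u i = lpn p s := by
  classical
  have hp' : 1 ≤ p' := by
    rw [← ENNReal.inv_le_one, ← h]; exact le_add_self
  by_cases h0 : lpn p s = 0
  · refine ⟨0, fun _ => le_rfl, ?_, ?_⟩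
    · rw [lpn_zero hp']; exact zero_le_one
    · simp [h0]
  by_cases hpt : p = ∞
  · subst hpt
    have : p' = 1 := by simpa using h
    subst this
    have hne : Nonempty ι := by
      by_contra hcon
      rw [not_nonempty_iff] at hcon
      exact h0 (by rw [lpn_top, Subsingleton.elim s 0, norm_zero])
    obtain ⟨i, hi⟩ := Finite.exists_max s
    -- for `p = ∞` the optimiser is the indicator of a maximal entry
    refine ⟨Pi.single i 1, fun j => ?_, ?_, ?_⟩
    · by_cases hj : j = i
      · subst hj; simp
      · simp [hj]
    · rw [lpn_of_ne_top le_rfl ENNReal.one_ne_top]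
      simp [Pi.single_apply, apply_ite abs]
    · simp only [Pi.single_apply, mul_ite, mul_one, mul_zero, Finset.sum_ite_eq',
        Finset.mem_univ, if_true]
      refine le_antisymm ((le_abs_self _).trans (abs_le_lpn le_top s i)) ?_
      exact lpn_top_le (hs i) fun j => by rw [abs_of_nonneg (hs j)]; exact hi j
  · have h1 := one_le_toReal hp hpt
    set c := lpn p s with hcdef
    have hc : 0 < c := lt_of_le_of_ne (lpn_nonneg hp s) (Ne.symm h0)
    have hsum := rpow_lpn_toReal hp hpt s
    rw [← hcdef] at hsum
    have hle := lpn_rpow_le hp hpt hp' hs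
    rw [← hcdef] at hle
    have hreal : p.toReal * p'⁻¹.toReal = p.toReal - 1 := by
      have h2 : p'⁻¹.toReal = 1 - p.toReal⁻¹ := by
        rw [ENNReal.toReal_inv]
        linarith [toReal_inv_add_toReal_inv h]
      rw [h2, mul_sub, mul_inv_cancel₀ (by positivity), mul_one]
    rw [hreal] at hle
    set a := p.toReal
    -- the equality case of Hölder's inequality: `u` is proportional to `s ^ (p - 1)`
    refine ⟨fun i => (c ^ (a - 1))⁻¹ * s i ^ (a - 1), fun i => ?_, ?_, ?_⟩
    · have := hs i
      positivity
    · rw [lpn_const_mul hp', abs_of_nonneg (by positivity)]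
      rw [inv_mul_le_one₀ (by positivity)]
      exact hle
    · have e : ∀ i, s i * ((c ^ (a - 1))⁻¹ * s i ^ (a - 1)) = (c ^ (a - 1))⁻¹ * |s i| ^ a := by
        intro i
        have : s i * s i ^ (a - 1) = s i ^ a := by
          nth_rw 1 [← Real.rpow_one (s i)]
          rw [← Real.rpow_add_of_nonneg (hs i) (by norm_num) (by linarith)]
          congr 1; ring
        rw [abs_of_nonneg (hs i), ← this]; ring
      simp only [e]
      rw [← Finset.mul_sum, ← hsum, ← Real.rpow_neg hc.le, ← Real.rpow_add hc]
      rw [show -(a - 1) + a = 1 by ring, Real.rpow_one]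

lemma lpn_prod (h1 : 1 ≤ t) (y : ι × κ → ℝ) :
    lpn t y = lpn t (fun i => lpn t (fun j => y (i, j))) := by
  by_cases ht : t = ∞
  · subst ht
    have hn : ∀ i, 0 ≤ lpn ∞ (fun j => y (i, j)) := fun i => lpn_nonneg le_top _
    refine le_antisymm (lpn_top_le (lpn_nonneg le_top _) fun x => ?_)
      (lpn_top_le (lpn_nonneg le_top _) fun i => ?_)
    · exact (abs_le_lpn (t := ∞) le_top (fun j => y (x.1, j)) x.2).trans ((le_abs_self _).trans
        (abs_le_lpn (t := ∞) le_top (fun i => lpn ∞ (fun j => y (i, j))) x.1))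
    · rw [abs_of_nonneg (hn i)]
      exact lpn_top_le (lpn_nonneg le_top _) fun j => abs_le_lpn (t := ∞) le_top y (i, j)
  · have hn : ∀ i, 0 ≤ lpn t (fun j => y (i, j)) := fun i => lpn_nonneg h1 _
    rw [lpn_of_ne_top h1 ht, lpn_of_ne_top h1 ht, Fintype.sum_prod_type]
    congr 1
    refine Finset.sum_congr rfl fun i _ => ?_
    rw [abs_of_nonneg (hn i), rpow_lpn_toReal h1 ht]

end LpNorm

/-! ### Hölder duality and the ideal property of Schatten norms -/

section Schatten
variable {ι κ : Type*} [Fintype ι] [Fintype κ] [DecidableEq ι] [DecidableEq κ] {t p p' : ℝ≥0∞}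

lemma one_le_of_inv_add_inv (h : p⁻¹ + p'⁻¹ = 1) : 1 ≤ p' := by
  rw [← ENNReal.inv_le_one, ← h]; exact le_add_self

lemma exists_inv_add_inv (hp : 1 ≤ p) : ∃ p' : ℝ≥0∞, p⁻¹ + p'⁻¹ = 1 :=
  ⟨(1 - p⁻¹)⁻¹, by rw [inv_inv]; exact add_tsub_cancel_of_le (ENNReal.inv_le_one.2 hp)⟩

lemma schatten_unitary_mul (h1 : 1 ≤ t) (U : Matrix.unitaryGroup ι ℂ) (A : Matrix ι ι ℂ) :
    schatten t ((U : Matrix ι ι ℂ) * A) = schatten t A := by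
  obtain ⟨W, V, s, -, rfl⟩ := exists_svd A
  rw [schatten_mul_diagonal_mul h1, ← mul_assoc, ← mul_assoc]
  exact schatten_mul_diagonal_mul h1 (U * W) V _

lemma schatten_mul_unitary (h1 : 1 ≤ t) (U : Matrix.unitaryGroup ι ℂ) (A : Matrix ι ι ℂ) :
    schatten t (A * (U : Matrix ι ι ℂ)) = schatten t A := by
  obtain ⟨W, V, s, -, rfl⟩ := exists_svd A
  rw [schatten_mul_diagonal_mul h1, mul_assoc]
  exact schatten_mul_diagonal_mul h1 W (V * U) _

lemma schatten_diagonal (h1 : 1 ≤ t) (d : ι → ℂ) :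
    schatten t (Matrix.diagonal d) = lpn t (fun i => ‖d i‖) := by
  simpa using schatten_mul_diagonal_mul h1 1 1 d

lemma schatten_svd (h1 : 1 ≤ t) (U V : Matrix.unitaryGroup ι ℂ) {s : ι → ℝ} (hs : ∀ i, 0 ≤ s i) :
    schatten t ((U : Matrix ι ι ℂ) * Matrix.diagonal (fun i => (s i : ℂ)) * (V : Matrix ι ι ℂ)) =
      lpn t s := by
  rw [schatten_mul_diagonal_mul h1]
  congr 1; funext i
  simp [abs_of_nonneg (hs i)]

lemma schatten_nonneg (h1 : 1 ≤ t) (A : Matrix ι ι ℂ) : 0 ≤ schatten t A := by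
  obtain ⟨U, V, s, hs, rfl⟩ := exists_svd A
  rw [schatten_svd h1 U V hs]
  exact lpn_nonneg h1 s

lemma schatten_zero (h1 : 1 ≤ t) : schatten t (0 : Matrix ι ι ℂ) = 0 := by
  rw [← Matrix.diagonal_zero, schatten_diagonal h1]
  simp only [norm_zero]
  exact lpn_zero h1

lemma eq_zero_of_schatten (h1 : 1 ≤ t) {A : Matrix ι ι ℂ} (h : schatten t A = 0) : A = 0 := by
  obtain ⟨U, V, s, hs, rfl⟩ := exists_svd A
  rw [schatten_svd h1 U V hs] at h
  simp [eq_zero_of_lpn h1 h]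

lemma schatten_pos (h1 : 1 ≤ t) {A : Matrix ι ι ℂ} (h : A ≠ 0) : 0 < schatten t A :=
  lt_of_le_of_ne (schatten_nonneg h1 A) fun h0 => h (eq_zero_of_schatten h1 h0.symm)

lemma schatten_smul (h1 : 1 ≤ t) (c : ℂ) (A : Matrix ι ι ℂ) :
    schatten t (c • A) = ‖c‖ * schatten t A := by
  obtain ⟨U, V, s, hs, rfl⟩ := exists_svd A
  rw [← Matrix.smul_mul, ← Matrix.mul_smul, ← Matrix.diagonal_smul, schatten_mul_diagonal_mul h1,
    schatten_mul_diagonal_mul h1]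
  simp only [Pi.smul_apply, smul_eq_mul, norm_mul]
  rw [lpn_const_mul h1, abs_of_nonneg (norm_nonneg c)]

lemma schatten_conjTranspose (h1 : 1 ≤ t) (A : Matrix ι ι ℂ) : schatten t Aᴴ = schatten t A := by
  obtain ⟨U, V, s, hs, rfl⟩ := exists_svd A
  rw [schatten_svd h1 U V hs, Matrix.conjTranspose_mul, Matrix.conjTranspose_mul,
    Matrix.diagonal_conjTranspose, ← mul_assoc]
  have : star (fun i => (s i : ℂ)) = fun i => (s i : ℂ) := by funext i; simp
  rw [this]
  exact schatten_svd h1 (star V) (star U) hs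

lemma schatten_top_le (h1 : 1 ≤ t) (A : Matrix ι ι ℂ) : schatten ∞ A ≤ schatten t A := by
  obtain ⟨U, V, s, hs, rfl⟩ := exists_svd A
  rw [schatten_svd h1 U V hs, schatten_svd le_top U V hs]
  exact lpn_top_le_lpn h1 s

lemma schatten_top_one_le : schatten ∞ (1 : Matrix ι ι ℂ) ≤ 1 := by
  rw [← Matrix.diagonal_one, schatten_diagonal le_top]
  exact lpn_top_le zero_le_one fun i => by simp

lemma sum_norm_sq_row (U : Matrix.unitaryGroup ι ℂ) (i : ι) :
    ∑ j, ‖(U : Matrix ι ι ℂ) i j‖ ^ 2 = 1 := by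
  have h := congrFun (congrFun (Matrix.mem_unitaryGroup_iff.1 U.2) i) i
  rw [Matrix.mul_apply, Matrix.one_apply_eq] at h
  have : ((∑ j, ‖(U : Matrix ι ι ℂ) i j‖ ^ 2 : ℝ) : ℂ) = 1 := by
    rw [← h]; push_cast
    refine Finset.sum_congr rfl fun j _ => ?_
    rw [Matrix.star_apply, RCLike.star_def, Complex.mul_conj, Complex.normSq_eq_norm_sq]
    push_cast; rfl
  exact_mod_cast this

lemma sum_norm_sq_col (U : Matrix.unitaryGroup ι ℂ) (j : ι) :
    ∑ i, ‖(U : Matrix ι ι ℂ) i j‖ ^ 2 = 1 := by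
  rw [← sum_norm_sq_row (star U) j]
  refine Finset.sum_congr rfl fun i _ => ?_
  simp [Matrix.star_apply]

/-- Hölder's inequality for Schatten norms: in singular value decompositions of `X` and `Y` the
trace is a sum over pairs of singular values, with weights dominated by a doubly stochastic
matrix. -/
theorem norm_trace_mul_le (hp : 1 ≤ p) (h : p⁻¹ + p'⁻¹ = 1) (X Y : Matrix ι ι ℂ) :
    ‖(X * Y).trace‖ ≤ schatten p X * schatten p' Y := by
  have hp' := one_le_of_inv_add_inv h
  obtain ⟨U, V, s, hs, rfl⟩ := exists_svd X
  obtain ⟨U', V', u, hu, rfl⟩ := exists_svd Y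
  rw [schatten_svd hp U V hs, schatten_svd hp' U' V' hu]
  set P : Matrix.unitaryGroup ι ℂ := V * U' with hP
  set Q : Matrix.unitaryGroup ι ℂ := V' * U with hQ
  have e : ((U : Matrix ι ι ℂ) * Matrix.diagonal (fun i => (s i : ℂ)) * (V : Matrix ι ι ℂ) *
      ((U' : Matrix ι ι ℂ) * Matrix.diagonal (fun i => (u i : ℂ)) * (V' : Matrix ι ι ℂ))).trace =
      ∑ i, ∑ j, (s i : ℂ) * (P : Matrix ι ι ℂ) i j * (u j * (Q : Matrix ι ι ℂ) j i) := by
    have : ((U : Matrix ι ι ℂ) * Matrix.diagonal (fun i => (s i : ℂ)) * (V : Matrix ι ι ℂ) *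
      ((U' : Matrix ι ι ℂ) * Matrix.diagonal (fun i => (u i : ℂ)) * (V' : Matrix ι ι ℂ))) =
      (U : Matrix ι ι ℂ) * (Matrix.diagonal (fun i => (s i : ℂ)) * (P : Matrix ι ι ℂ) *
        (Matrix.diagonal (fun i => (u i : ℂ)) * (V' : Matrix ι ι ℂ))) := by
      simp only [hP, Submonoid.coe_mul, mul_assoc]
    rw [this, Matrix.trace_mul_comm]
    have : Matrix.diagonal (fun i => (s i : ℂ)) * (P : Matrix ι ι ℂ) *
        (Matrix.diagonal (fun i => (u i : ℂ)) * (V' : Matrix ι ι ℂ)) * (U : Matrix ι ι ℂ) =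
        (Matrix.diagonal (fun i => (s i : ℂ)) * (P : Matrix ι ι ℂ)) *
        (Matrix.diagonal (fun i => (u i : ℂ)) * (Q : Matrix ι ι ℂ)) := by
      simp only [hQ, Submonoid.coe_mul, mul_assoc]
    rw [this, Matrix.trace]
    simp only [Matrix.diag_apply, Matrix.mul_apply (M := _ * _), Matrix.diagonal_mul]
  rw [e]
  refine le_trans ?_ (sum_mul_mul_le_lpn_mul_lpn hp h s u
    (fun i j => (‖(P : Matrix ι ι ℂ) i j‖ ^ 2 + ‖(Q : Matrix ι ι ℂ) j i‖ ^ 2) / 2) hs hu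
    (fun i j => by positivity) (fun i => ?_) (fun j => ?_))
  · refine (norm_sum_le _ _).trans (Finset.sum_le_sum fun i _ => (norm_sum_le _ _).trans
      (Finset.sum_le_sum fun j _ => ?_))
    rw [norm_mul, norm_mul, norm_mul, Complex.norm_real, Complex.norm_real, Real.norm_eq_abs,
      Real.norm_eq_abs, abs_of_nonneg (hs i), abs_of_nonneg (hu j)]
    have h1 := mul_nonneg (hs i) (hu j)
    have h2 : ‖(P : Matrix ι ι ℂ) i j‖ * ‖(Q : Matrix ι ι ℂ) j i‖ ≤
        (‖(P : Matrix ι ι ℂ) i j‖ ^ 2 + ‖(Q : Matrix ι ι ℂ) j i‖ ^ 2) / 2 := by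
      linarith [two_mul_le_add_sq ‖(P : Matrix ι ι ℂ) i j‖ ‖(Q : Matrix ι ι ℂ) j i‖]
    calc _ = s i * u j * (‖(P : Matrix ι ι ℂ) i j‖ * ‖(Q : Matrix ι ι ℂ) j i‖) := by ring
      _ ≤ _ := mul_le_mul_of_nonneg_left h2 h1
  · rw [← Finset.sum_div, Finset.sum_add_distrib, sum_norm_sq_row, sum_norm_sq_col]; norm_num
  · rw [← Finset.sum_div, Finset.sum_add_distrib, sum_norm_sq_row, sum_norm_sq_col]; norm_num

/-- Hölder's inequality for the trace pairing is attained. -/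
theorem exists_trace_mul_eq_schatten (hp : 1 ≤ p) (h : p⁻¹ + p'⁻¹ = 1) (X : Matrix ι ι ℂ) :
    ∃ Y : Matrix ι ι ℂ, schatten p' Y ≤ 1 ∧ (X * Y).trace = (schatten p X : ℂ) := by
  have hp' := one_le_of_inv_add_inv h
  obtain ⟨U, V, s, hs, rfl⟩ := exists_svd X
  obtain ⟨u, hu, hu1, hsu⟩ := exists_sum_mul_eq_lpn hp h s hs
  refine ⟨((star V : Matrix.unitaryGroup ι ℂ) : Matrix ι ι ℂ) *
    Matrix.diagonal (fun i => (u i : ℂ)) * ((star U : Matrix.unitaryGroup ι ℂ) : Matrix ι ι ℂ),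
    ?_, ?_⟩
  · rwa [schatten_svd hp' _ _ hu]
  · rw [schatten_svd hp U V hs, ← hsu]
    have : ((U : Matrix ι ι ℂ) * Matrix.diagonal (fun i => (s i : ℂ)) * (V : Matrix ι ι ℂ)) *
      (((star V : Matrix.unitaryGroup ι ℂ) : Matrix ι ι ℂ) *
    Matrix.diagonal (fun i => (u i : ℂ)) * ((star U : Matrix.unitaryGroup ι ℂ) : Matrix ι ι ℂ)) =
      conjDiag U (fun i => (s i : ℂ) * (u i : ℂ)) := by
      rw [conjDiag_apply, ← Matrix.diagonal_mul_diagonal]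
      simp only [Unitary.coe_star, mul_assoc]
      rw [← mul_assoc (V : Matrix ι ι ℂ) (star (V : Matrix ι ι ℂ)),
        Unitary.mul_star_self_of_mem V.2, one_mul]
    rw [this, trace_conjDiag]
    push_cast; rfl

lemma schatten_le_of_forall_trace (hp : 1 ≤ p) (h : p⁻¹ + p'⁻¹ = 1) {X : Matrix ι ι ℂ} {C : ℝ}
    (hC : ∀ Y : Matrix ι ι ℂ, schatten p' Y ≤ 1 → ‖(X * Y).trace‖ ≤ C) : schatten p X ≤ C := by
  obtain ⟨Y, hY, e⟩ := exists_trace_mul_eq_schatten hp h X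
  have := hC Y hY
  rw [e, Complex.norm_real, Real.norm_eq_abs] at this
  exact (le_abs_self _).trans this

lemma schatten_add_le (h1 : 1 ≤ t) (X Y : Matrix ι ι ℂ) :
    schatten t (X + Y) ≤ schatten t X + schatten t Y := by
  obtain ⟨t', ht⟩ := exists_inv_add_inv h1
  refine schatten_le_of_forall_trace h1 ht fun Z hZ => ?_
  rw [add_mul, Matrix.trace_add]
  have hx := schatten_nonneg h1 X
  have hy := schatten_nonneg h1 Y
  exact (norm_add_le _ _).trans (add_le_add
    ((norm_trace_mul_le h1 ht X Z).trans (mul_le_of_le_one_right hx hZ))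
    ((norm_trace_mul_le h1 ht Y Z).trans (mul_le_of_le_one_right hy hZ)))

/-- A contraction is the mean of two unitaries: its singular values `s ≤ 1` are the means of the
unimodular numbers `s ± i √(1 - s²)`. This gives the ideal property of the Schatten norms from
their unitary invariance and the triangle inequality. -/
lemma exists_unitary_add_unitary {A : Matrix ι ι ℂ} (hA : schatten ∞ A ≤ 1) :
    ∃ U V : Matrix.unitaryGroup ι ℂ,
      A = (1 / 2 : ℂ) • ((U : Matrix ι ι ℂ) + (V : Matrix ι ι ℂ)) := by
  obtain ⟨U, V, s, hs, rfl⟩ := exists_svd A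
  rw [schatten_svd le_top U V hs] at hA
  have hs1 : ∀ i, s i ≤ 1 := fun i =>
    ((le_abs_self _).trans (abs_le_lpn (t := ∞) le_top s i)).trans hA
  have hmem : ∀ w : ι → ℂ, (∀ i, w i * star (w i) = 1) →
      Matrix.diagonal w ∈ Matrix.unitaryGroup ι ℂ := fun w hw => by
    rw [Matrix.mem_unitaryGroup_iff, Matrix.star_eq_conjTranspose, Matrix.diagonal_conjTranspose,
      Matrix.diagonal_mul_diagonal, ← Matrix.diagonal_one]
    exact congrArg _ (funext hw)
  have hsq : ∀ i, (√(1 - s i ^ 2)) ^ 2 = 1 - s i ^ 2 := fun i =>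
    Real.sq_sqrt (by nlinarith [hs i, hs1 i])
  have hw : ∀ ε : ℝ, ε ^ 2 = 1 → ∀ i, ((s i : ℂ) + (ε * √(1 - s i ^ 2) : ℝ) * Complex.I) *
      star ((s i : ℂ) + (ε * √(1 - s i ^ 2) : ℝ) * Complex.I) = 1 := fun ε hε i => by
    rw [RCLike.star_def, Complex.mul_conj, Complex.normSq_add_mul_I, mul_pow, hε, hsq]
    norm_num
  refine ⟨U * ⟨_, hmem _ (hw 1 (by norm_num))⟩ * V, U * ⟨_, hmem _ (hw (-1) (by norm_num))⟩ * V, ?_⟩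
  simp only [Submonoid.coe_mul]
  rw [← add_mul, ← mul_add, ← Matrix.smul_mul, ← Matrix.mul_smul, Matrix.diagonal_add,
    ← Matrix.diagonal_smul]
  congr 3
  funext i
  simp only [Pi.smul_apply, smul_eq_mul]
  push_cast; ring

lemma schatten_mul_le_of_contraction (h1 : 1 ≤ t) {A : Matrix ι ι ℂ} (hA : schatten ∞ A ≤ 1)
    (X : Matrix ι ι ℂ) : schatten t (A * X) ≤ schatten t X := by
  obtain ⟨U, V, rfl⟩ := exists_unitary_add_unitary hA
  rw [Matrix.smul_mul, schatten_smul h1, add_mul]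
  have := schatten_add_le h1 ((U : Matrix ι ι ℂ) * X) ((V : Matrix ι ι ℂ) * X)
  rw [schatten_unitary_mul h1, schatten_unitary_mul h1] at this
  norm_num
  linarith

lemma schatten_mul_le_left (h1 : 1 ≤ t) (A X : Matrix ι ι ℂ) :
    schatten t (A * X) ≤ schatten ∞ A * schatten t X := by
  by_cases h0 : schatten ∞ A = 0
  · rw [eq_zero_of_schatten le_top h0, zero_mul, schatten_zero h1, schatten_zero le_top, zero_mul]
  have hpos : 0 < schatten ∞ A := lt_of_le_of_ne (schatten_nonneg le_top A) (Ne.symm h0)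
  have hn : ‖((schatten ∞ A : ℝ) : ℂ)⁻¹‖ = (schatten ∞ A)⁻¹ := by
    rw [norm_inv, Complex.norm_real, Real.norm_eq_abs, abs_of_pos hpos]
  have := schatten_mul_le_of_contraction h1 (A := ((schatten ∞ A : ℝ) : ℂ)⁻¹ • A)
    (by rw [schatten_smul le_top, hn, inv_mul_cancel₀ h0]) X
  rw [Matrix.smul_mul, schatten_smul h1, hn, inv_mul_le_iff₀ hpos] at this
  exact this

lemma schatten_mul_le_right (h1 : 1 ≤ t) (X B : Matrix ι ι ℂ) :
    schatten t (X * B) ≤ schatten t X * schatten ∞ B := by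
  rw [← schatten_conjTranspose h1, Matrix.conjTranspose_mul, mul_comm (schatten t X),
    ← schatten_conjTranspose h1 X, ← schatten_conjTranspose le_top B]
  exact schatten_mul_le_left h1 _ _

lemma kronecker_mem_unitaryGroup (U : Matrix.unitaryGroup ι ℂ) (V : Matrix.unitaryGroup κ ℂ) :
    (U : Matrix ι ι ℂ) ⊗ₖ (V : Matrix κ κ ℂ) ∈ Matrix.unitaryGroup (ι × κ) ℂ := by
  rw [Matrix.mem_unitaryGroup_iff, Matrix.star_eq_conjTranspose, Matrix.conjTranspose_kronecker,
    ← Matrix.mul_kronecker_mul, ← Matrix.star_eq_conjTranspose, ← Matrix.star_eq_conjTranspose,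
    Unitary.mul_star_self_of_mem U.2, Unitary.mul_star_self_of_mem V.2, Matrix.one_kronecker_one]

lemma schatten_kronecker (h1 : 1 ≤ t) (A : Matrix ι ι ℂ) (B : Matrix κ κ ℂ) :
    schatten t (A ⊗ₖ B) = schatten t A * schatten t B := by
  obtain ⟨U, V, s, hs, rfl⟩ := exists_svd A
  obtain ⟨U', V', u, hu, rfl⟩ := exists_svd B
  rw [schatten_svd h1 U V hs, schatten_svd h1 U' V' hu, Matrix.mul_kronecker_mul,
    Matrix.mul_kronecker_mul, Matrix.diagonal_kronecker_diagonal]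
  refine (schatten_mul_diagonal_mul h1 ⟨_, kronecker_mem_unitaryGroup U U'⟩
    ⟨_, kronecker_mem_unitaryGroup V V'⟩ _).trans ?_
  rw [lpn_prod h1]
  have : ∀ i, lpn t (fun j => ‖(s i : ℂ) * (u j : ℂ)‖) = lpn t u * s i := fun i => by
    rw [mul_comm, ← abs_of_nonneg (hs i), ← lpn_const_mul h1]
    congr 1; funext j
    rw [norm_mul, Complex.norm_real, Complex.norm_real, Real.norm_eq_abs, Real.norm_eq_abs,
      abs_abs, abs_of_nonneg (hu j), abs_of_nonneg (hs i)]
  simp only [this]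
  rw [lpn_const_mul h1, abs_of_nonneg (lpn_nonneg h1 u), mul_comm]

/-- The Schatten norm with exponent `2` is the Hilbert–Schmidt norm. -/
lemma schatten_two_sq (A : Matrix ι ι ℂ) : schatten 2 A ^ 2 = ∑ i, ∑ j, ‖A i j‖ ^ 2 := by
  have htr : ∀ B : Matrix ι ι ℂ, ((∑ i, ∑ j, ‖B i j‖ ^ 2 : ℝ) : ℂ) = (B * Bᴴ).trace := fun B => by
    rw [Matrix.trace]
    push_cast
    refine Finset.sum_congr rfl fun i _ => ?_
    rw [Matrix.diag_apply, Matrix.mul_apply]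
    refine Finset.sum_congr rfl fun j _ => ?_
    rw [Matrix.conjTranspose_apply, RCLike.star_def, Complex.mul_conj, Complex.normSq_eq_norm_sq]
    push_cast; rfl
  obtain ⟨U, V, s, hs, hA⟩ := exists_svd A
  have h : schatten 2 A ^ 2 = ∑ i, s i ^ 2 := by
    rw [hA, schatten_svd one_le_two U V hs]
    have := rpow_lpn_toReal (t := 2) one_le_two (by simp) s
    simpa using this
  have hAA : A * Aᴴ = conjDiag U (fun i => ((s i ^ 2 : ℝ) : ℂ)) := by
    rw [conjDiag_apply, hA, Matrix.conjTranspose_mul, Matrix.conjTranspose_mul,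
      Matrix.diagonal_conjTranspose]
    have : (fun i => ((s i ^ 2 : ℝ) : ℂ)) = fun i => (s i : ℂ) * star (fun i => (s i : ℂ)) i := by
      funext i; simp [sq]
    rw [this, ← Matrix.diagonal_mul_diagonal]
    simp only [← Matrix.star_eq_conjTranspose, mul_assoc]
    rw [← mul_assoc (V : Matrix ι ι ℂ) (star (V : Matrix ι ι ℂ)),
        Unitary.mul_star_self_of_mem V.2, one_mul]
  have h2 := htr A
  rw [hAA, trace_conjDiag, ← Complex.ofReal_sum] at h2
  rw [h]
  exact_mod_cast h2.symm

end Schatten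

/-! ### Complex interpolation -/

/-- The power `a ^ w` of a non-negative real `a`, with `0 ^ w = 0` for every `w`, so that it is an
entire function of `w`. -/
noncomputable def entirePow (a : ℝ) (w : ℂ) : ℂ := if a = 0 then 0 else Complex.exp (w * Real.log a)

lemma entirePow_one {a : ℝ} (ha : 0 ≤ a) : entirePow a 1 = a := by
  unfold entirePow
  split_ifs with h
  · simp [h]
  · rw [one_mul, ← Complex.ofReal_exp, Real.exp_log (lt_of_le_of_ne ha (Ne.symm h))]

lemma norm_entirePow_le {a : ℝ} (ha : 0 ≤ a) (w : ℂ) : ‖entirePow a w‖ ≤ a ^ w.re := by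
  unfold entirePow
  split_ifs with h
  · rw [norm_zero]; positivity
  · rw [Complex.norm_exp, Complex.re_mul_ofReal,
      Real.rpow_def_of_pos (lt_of_le_of_ne ha (Ne.symm h)), mul_comm]

/-- The map `s ↦ s ^ w` takes the unit ball of `ℓ^a` to that of `ℓ^c` when `re w = a / c`, also for
`c = ∞`. -/
lemma lpn_entirePow_le {ι : Type*} [Fintype ι] {a c : ℝ≥0∞} (ha : 1 ≤ a) (ha' : a ≠ ∞)
    (hc : 1 ≤ c) {s : ι → ℝ} (hs : ∀ i, 0 ≤ s i) (h : lpn a s ≤ 1) {w : ℂ}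
    (hw : w.re = a.toReal * c⁻¹.toReal) : lpn c (fun i => ‖entirePow (s i) w‖) ≤ 1 := by
  refine (lpn_mono hc fun i => ?_).trans ((lpn_rpow_le ha ha' hc hs).trans
    (Real.rpow_le_one (lpn_nonneg ha s) h (by positivity)))
  rw [abs_of_nonneg (norm_nonneg _), abs_of_nonneg (Real.rpow_nonneg (hs i) _), ← hw]
  exact norm_entirePow_le (hs i) w

/-- An entire function that is bounded on the strip `0 ≤ re z ≤ 1`. -/
def StripBounded (f : ℂ → ℂ) : Prop :=
  Differentiable ℂ f ∧ ∃ C, ∀ z : ℂ, 0 ≤ z.re → z.re ≤ 1 → ‖f z‖ ≤ C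

namespace StripBounded

lemma const (c : ℂ) : StripBounded fun _ => c :=
  ⟨differentiable_const c, ‖c‖, fun _ _ _ => le_rfl⟩

lemma mul {f g : ℂ → ℂ} (hf : StripBounded f) (hg : StripBounded g) :
    StripBounded fun z => f z * g z := by
  obtain ⟨hf, C, hC⟩ := hf
  obtain ⟨hg, D, hD⟩ := hg
  refine ⟨hf.mul hg, C * D, fun z h0 h1 => ?_⟩
  rw [norm_mul]
  exact mul_le_mul (hC z h0 h1) (hD z h0 h1) (norm_nonneg _)
    ((norm_nonneg _).trans (hC z h0 h1))

lemma sum {α : Type*} [Fintype α] {f : α → ℂ → ℂ} (hf : ∀ i, StripBounded (f i)) :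
    StripBounded fun z => ∑ i, f i z := by
  choose hd C hC using hf
  exact ⟨Differentiable.fun_sum fun i _ => hd i, ∑ i, C i, fun z h0 h1 =>
    (norm_sum_le _ _).trans (Finset.sum_le_sum fun i _ => hC i z h0 h1)⟩

lemma of_entirePow (a α β : ℝ) : StripBounded fun z => entirePow a (α * z + β) := by
  unfold entirePow
  split_ifs with h
  · exact const 0
  · refine ⟨by fun_prop, Real.exp (|α| * |Real.log a| + |β| * |Real.log a|), fun z h0 h1 => ?_⟩
    rw [Complex.norm_exp, Real.exp_le_exp]
    rw [Complex.re_mul_ofReal]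
    simp only [Complex.add_re, Complex.ofReal_re, Complex.re_ofReal_mul]
    calc (α * z.re + β) * Real.log a ≤ |(α * z.re + β) * Real.log a| := le_abs_self _
      _ ≤ (|α| * 1 + |β|) * |Real.log a| := by
        rw [abs_mul]
        gcongr
        refine (abs_add_le _ _).trans ?_
        rw [abs_mul, abs_of_nonneg h0]
        gcongr
      _ = _ := by ring

lemma matrix_mul {ι : Type*} [Fintype ι] {M N : ℂ → Matrix ι ι ℂ}
    (hM : ∀ i j, StripBounded fun z => M z i j) (hN : ∀ i j, StripBounded fun z => N z i j)
    (i j : ι) : StripBounded fun z => (M z * N z) i j := by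
  simp only [Matrix.mul_apply]
  exact sum fun k => (hM i k).mul (hN k j)

lemma matrix_trace {ι : Type*} [Fintype ι] {M : ℂ → Matrix ι ι ℂ}
    (hM : ∀ i j, StripBounded fun z => M z i j) : StripBounded fun z => (M z).trace :=
  sum fun i => hM i i

lemma matrix_diagonal {ι : Type*} [DecidableEq ι] {d : ι → ℂ → ℂ}
    (hd : ∀ i, StripBounded (d i)) (i j : ι) :
    StripBounded fun z => Matrix.diagonal (fun k => d k z) i j := by
  by_cases h : i = j
  · subst h; simpa only [Matrix.diagonal_apply_eq] using hd i
  · simpa only [Matrix.diagonal_apply_ne _ h] using const 0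

/-- The three lines theorem with bound `1` on both boundary lines. -/
lemma norm_le_one {f : ℂ → ℂ} (hf : StripBounded f) (h0 : ∀ z : ℂ, z.re = 0 → ‖f z‖ ≤ 1)
    (h1 : ∀ z : ℂ, z.re = 1 → ‖f z‖ ≤ 1) {x : ℝ} (hx0 : 0 ≤ x) (hx1 : x ≤ 1) : ‖f x‖ ≤ 1 := by
  obtain ⟨hd, C, hC⟩ := hf
  have := Complex.HadamardThreeLines.norm_le_interp_of_mem_verticalClosedStrip' (f := f)
    (z := (x : ℂ)) (a := 1) (b := 1) (l := 0) (u := 1) zero_lt_one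
    ⟨by simpa using hx0, by simpa using hx1⟩ hd.diffContOnCl
    ⟨C, by rintro _ ⟨z, hz, rfl⟩; exact hC z hz.1 hz.2⟩ h0 h1
  simpa using this

end StripBounded

section
variable {ι κ : Type*} [Fintype ι] [Fintype κ] [DecidableEq ι] [DecidableEq κ]

/-- The entire family `w ↦ U s ^ w V`, which passes through the matrix `U s V` at `w = 1`. -/
noncomputable def svdPow (U V : Matrix.unitaryGroup ι ℂ) (s : ι → ℝ) (w : ℂ) : Matrix ι ι ℂ :=
  (U : Matrix ι ι ℂ) * Matrix.diagonal (fun i => entirePow (s i) w) * (V : Matrix ι ι ℂ)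

lemma svdPow_one (U V : Matrix.unitaryGroup ι ℂ) {s : ι → ℝ} (hs : ∀ i, 0 ≤ s i) :
    svdPow U V s 1 =
      (U : Matrix ι ι ℂ) * Matrix.diagonal (fun i => (s i : ℂ)) * (V : Matrix ι ι ℂ) := by
  simp only [svdPow, entirePow_one (hs _)]

lemma schatten_svdPow_le {a c : ℝ≥0∞} (ha : 1 ≤ a) (ha' : a ≠ ∞) (hc : 1 ≤ c)
    (U V : Matrix.unitaryGroup ι ℂ) {s : ι → ℝ} (hs : ∀ i, 0 ≤ s i) (h : lpn a s ≤ 1) {w : ℂ}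
    (hw : w.re = a.toReal * c⁻¹.toReal) : schatten c (svdPow U V s w) ≤ 1 := by
  rw [svdPow, schatten_mul_diagonal_mul hc]
  exact lpn_entirePow_le ha ha' hc hs h hw

lemma StripBounded.of_svdPow (U V : Matrix.unitaryGroup ι ℂ) (s : ι → ℝ) (α β : ℝ) (i j : ι) :
    StripBounded fun z => svdPow U V s (α * z + β) i j :=
  StripBounded.matrix_mul (N := fun _ => (V : Matrix ι ι ℂ))
    (StripBounded.matrix_mul (M := fun _ => (U : Matrix ι ι ℂ))
      (fun _ _ => StripBounded.const _)
      (StripBounded.matrix_diagonal fun k => StripBounded.of_entirePow (s k) α β))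
    (fun _ _ => StripBounded.const _) i j

/-- The case of finite exponents and matrices of norm at most `1` in `schatten_mul_le`. -/
lemma schatten_mul_le_one {a b c : ℝ≥0∞} (hc : 1 ≤ c) (h : c⁻¹ = a⁻¹ + b⁻¹) (ha' : a ≠ ∞)
    (hb' : b ≠ ∞) {A B : Matrix ι ι ℂ} (hA : schatten a A ≤ 1) (hB : schatten b B ≤ 1) :
    schatten c (A * B) ≤ 1 := by
  have hc1 : c⁻¹ ≤ 1 := ENNReal.inv_le_one.2 hc
  have ha : 1 ≤ a := ENNReal.inv_le_one.1 ((le_self_add.trans h.ge).trans hc1)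
  have hb : 1 ≤ b := ENNReal.inv_le_one.1 ((le_add_self.trans h.ge).trans hc1)
  obtain ⟨c', hcc⟩ := exists_inv_add_inv hc
  obtain ⟨U, V, s, hs, rfl⟩ := exists_svd A
  obtain ⟨U', V', u, hu, rfl⟩ := exists_svd B
  rw [schatten_svd ha U V hs] at hA
  rw [schatten_svd hb U' V' hu] at hB
  have ha1 := one_le_toReal ha ha'
  have hb1 := one_le_toReal hb hb'
  have hreal : c⁻¹.toReal = a.toReal⁻¹ + b.toReal⁻¹ := by
    rw [h, ENNReal.toReal_add (ENNReal.inv_ne_top.2 (by positivity))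
      (ENNReal.inv_ne_top.2 (by positivity)), ENNReal.toReal_inv, ENNReal.toReal_inv]
  set α := a.toReal * c⁻¹.toReal with hα
  set β := b.toReal * c⁻¹.toReal with hβ
  have hκ : 0 < c⁻¹.toReal := by rw [hreal]; positivity
  refine schatten_le_of_forall_trace hc hcc fun C hC => ?_
  -- at `z = 1 / β` both exponents are `1`, and the family passes through the given matrices
  have hF : StripBounded fun z => ((svdPow U V s ((-α : ℝ) * z + α) *
      svdPow U' V' u ((β : ℝ) * z + (0 : ℝ))) * C).trace :=
    StripBounded.matrix_trace (StripBounded.matrix_mul (StripBounded.matrix_mul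
      (StripBounded.of_svdPow U V s (-α) α) (StripBounded.of_svdPow U' V' u β 0))
      (fun i j => StripBounded.const _))
  have hbound : ∀ M : Matrix ι ι ℂ, schatten c M ≤ 1 → ‖(M * C).trace‖ ≤ 1 := fun M hM =>
    (norm_trace_mul_le hc hcc M C).trans
      (mul_le_one₀ hM (schatten_nonneg (one_le_of_inv_add_inv hcc) C) hC)
  have hx : β⁻¹ ≤ 1 := by
    rw [hβ, hreal]
    refine inv_le_one_of_one_le₀ ?_
    rw [mul_add, mul_inv_cancel₀ (by positivity)]
    have : 0 ≤ b.toReal * a.toReal⁻¹ := by positivity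
    linarith
  have hβ0 : β ≠ 0 := by positivity
  have key := hF.norm_le_one (fun z hz => ?_) (fun z hz => ?_) (x := β⁻¹) (by positivity) hx
  · have e1 : ((-α : ℝ) : ℂ) * ((β⁻¹ : ℝ) : ℂ) + (α : ℂ) = 1 := by
      have : -α * β⁻¹ + α = 1 := by
        rw [hα, hβ, hreal]
        field_simp
        ring
      exact_mod_cast this
    have e2 : (β : ℂ) * ((β⁻¹ : ℝ) : ℂ) + ((0 : ℝ) : ℂ) = 1 := by
      have : β * β⁻¹ + 0 = 1 := by rw [add_zero, mul_inv_cancel₀ hβ0]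
      exact_mod_cast this
    rw [e1, e2, svdPow_one U V hs, svdPow_one U' V' hu] at key
    exact key
  · refine hbound _ ((schatten_mul_le_right hc _ _).trans (mul_le_one₀ ?_
      (schatten_nonneg le_top _) ?_))
    · exact schatten_svdPow_le ha ha' hc U V hs hA (by simp [hz, hα])
    · exact schatten_svdPow_le hb hb' le_top U' V' hu hB (by simp [hz])
  · refine hbound _ ((schatten_mul_le_left hc _ _).trans (mul_le_one₀ ?_
      (schatten_nonneg hc _) ?_))
    · exact schatten_svdPow_le ha ha' le_top U V hs hA (by simp [hz])
    · exact schatten_svdPow_le hb hb' hc U' V' hu hB (by simp [hz, hβ])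

lemma exists_smul_schatten_le_one {t : ℝ≥0∞} (h1 : 1 ≤ t) (A : Matrix ι ι ℂ) :
    ∃ A' : Matrix ι ι ℂ, schatten t A' ≤ 1 ∧ A = ((schatten t A : ℝ) : ℂ) • A' := by
  by_cases h0 : schatten t A = 0
  · exact ⟨0, by rw [schatten_zero h1]; exact zero_le_one, by
      rw [smul_zero]; exact eq_zero_of_schatten h1 h0⟩
  · refine ⟨((schatten t A : ℝ) : ℂ)⁻¹ • A, ?_, ?_⟩
    · rw [schatten_smul h1, norm_inv, Complex.norm_real, Real.norm_eq_abs,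
        abs_of_nonneg (schatten_nonneg h1 A), inv_mul_cancel₀ h0]
    · rw [smul_smul, mul_inv_cancel₀ (by exact_mod_cast h0), one_smul]

/-- The general Hölder inequality for Schatten norms. With `A = U s V` and `B = U' u V'` of norm
`1`, the families `U s ^ ((1 - z) a / c) V` and `U' u ^ (z b / c) V'` are contractive in the pairs
of exponents `(c, ∞)` and `(∞, c)` on the two boundary lines of the strip. -/
theorem schatten_mul_le {a b c : ℝ≥0∞} (hc : 1 ≤ c) (h : c⁻¹ = a⁻¹ + b⁻¹) (A B : Matrix ι ι ℂ) :
    schatten c (A * B) ≤ schatten a A * schatten b B := by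
  have hc1 : c⁻¹ ≤ 1 := ENNReal.inv_le_one.2 hc
  have ha : 1 ≤ a := ENNReal.inv_le_one.1 ((le_self_add.trans h.ge).trans hc1)
  have hb : 1 ≤ b := ENNReal.inv_le_one.1 ((le_add_self.trans h.ge).trans hc1)
  by_cases ha' : a = ∞
  · subst ha'
    have : c = b := by simpa using h
    subst this
    exact schatten_mul_le_left hc A B
  by_cases hb' : b = ∞
  · subst hb'
    have : c = a := by simpa using h
    subst this
    exact schatten_mul_le_right hc A B
  obtain ⟨A', hA', eA⟩ := exists_smul_schatten_le_one ha A
  obtain ⟨B', hB', eB⟩ := exists_smul_schatten_le_one hb B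
  have hAB : A * B = ((schatten a A * schatten b B : ℝ) : ℂ) • (A' * B') := by
    conv_lhs => rw [eA, eB]
    rw [Matrix.smul_mul, Matrix.mul_smul, smul_smul]
    push_cast; rfl
  have hn := mul_nonneg (schatten_nonneg ha A) (schatten_nonneg hb B)
  rw [hAB, schatten_smul hc, Complex.norm_real, Real.norm_eq_abs, abs_of_nonneg hn]
  exact mul_le_of_le_one_right hn (schatten_mul_le_one hc h ha' hb' hA' hB')

lemma schatten_two_kronecker_one_mul_diagonal_le (A : Matrix ι ι ℂ) (hA : schatten 2 A ≤ 1)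
    (w : ι × κ → ℂ) (hw : ∀ i, lpn 2 (fun j => ‖w (i, j)‖) ≤ 1) :
    schatten 2 ((A ⊗ₖ (1 : Matrix κ κ ℂ)) * Matrix.diagonal w) ≤ 1 := by
  have hw' : ∀ i, ∑ j, ‖w (i, j)‖ ^ 2 ≤ 1 := fun i => by
    have h1 := rpow_lpn_toReal (t := 2) one_le_two (by simp) (fun j => ‖w (i, j)‖)
    simp only [ENNReal.toReal_ofNat, Real.rpow_ofNat, abs_norm] at h1
    rw [← h1]
    exact pow_le_one₀ (lpn_nonneg one_le_two _) (hw i)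
  have h2 := schatten_two_sq ((A ⊗ₖ (1 : Matrix κ κ ℂ)) * Matrix.diagonal w)
  have h3 : schatten 2 ((A ⊗ₖ (1 : Matrix κ κ ℂ)) * Matrix.diagonal w) ^ 2 ≤ schatten 2 A ^ 2 := by
    rw [h2, schatten_two_sq, Fintype.sum_prod_type]
    refine Finset.sum_le_sum fun k _ => ?_
    have e : ∀ l, ∑ x : ι × κ, ‖((A ⊗ₖ (1 : Matrix κ κ ℂ)) * Matrix.diagonal w) (k, l) x‖ ^ 2 =
        ∑ i, ‖A k i‖ ^ 2 * ‖w (i, l)‖ ^ 2 := fun l => by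
      rw [Fintype.sum_prod_type]
      refine Finset.sum_congr rfl fun i _ => ?_
      rw [Finset.sum_eq_single l]
      · simp [Matrix.mul_diagonal, mul_pow]
      · intro j _ hj
        simp [Matrix.mul_diagonal, Matrix.one_apply_ne (Ne.symm hj)]
      · simp
    simp only [e]
    rw [Finset.sum_comm]
    refine Finset.sum_le_sum fun i _ => ?_
    rw [← Finset.mul_sum]
    exact mul_le_of_le_one_right (by positivity) (hw' i)
  have h4 := schatten_nonneg one_le_two A
  exact (abs_le_of_sq_le_sq' (by nlinarith : _ ≤ (1 : ℝ) ^ 2) zero_le_one).2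

lemma schatten_kronecker_one_mul_diagonal_le_one {t : ℝ≥0∞} (h2 : 2 ≤ t) (ht : t ≠ ∞)
    {A : Matrix ι ι ℂ} (hA : schatten t A ≤ 1) (w : ι × κ → ℝ) (hw0 : ∀ x, 0 ≤ w x)
    (hw : ∀ i, lpn t (fun j => w (i, j)) ≤ 1) :
    schatten t ((A ⊗ₖ (1 : Matrix κ κ ℂ)) * Matrix.diagonal (fun x => (w x : ℂ))) ≤ 1 := by
  have h1 : 1 ≤ t := one_le_two.trans h2
  obtain ⟨t', htt⟩ := exists_inv_add_inv h1
  have ht1' := one_le_of_inv_add_inv htt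
  have htt' : t' ≠ ∞ := by
    rintro rfl
    have : t = 1 := by simpa using htt
    rw [this] at h2
    exact absurd h2 (by norm_num)
  have htr : 2 ≤ t.toReal := by simpa using ENNReal.toReal_mono ht h2
  have htr' := one_le_toReal ht1' htt'
  have hreal := toReal_inv_add_toReal_inv htt
  refine schatten_le_of_forall_trace h1 htt fun C hC => ?_
  obtain ⟨U, V, s, hs, rfl⟩ := exists_svd A
  obtain ⟨U', V', u, hu, rfl⟩ := exists_svd C
  rw [schatten_svd h1 U V hs] at hA
  rw [schatten_svd ht1' U' V' hu] at hC
  set τ := t.toReal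
  set τ' := t'.toReal
  -- the exponents `τ z / 2` and `τ' (1 - z / 2)` interpolate between the trace pairing of operator
  -- and trace norm at `re z = 0` and the Hilbert–Schmidt pairing at `re z = 1`; they are `1` at
  -- `z = 2 / τ`
  have hF : StripBounded fun z => (((svdPow U V s ((τ / 2 : ℝ) * z + (0 : ℝ)) ⊗ₖ
        (1 : Matrix κ κ ℂ)) *
      Matrix.diagonal (fun x => entirePow (w x) ((τ / 2 : ℝ) * z + (0 : ℝ)))) *
      svdPow U' V' u ((-(τ' / 2) : ℝ) * z + τ')).trace :=
    StripBounded.matrix_trace (StripBounded.matrix_mul (StripBounded.matrix_mul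
      (fun i j => (StripBounded.of_svdPow U V s (τ / 2) 0 i.1 j.1).mul (StripBounded.const _))
      (StripBounded.matrix_diagonal fun x => StripBounded.of_entirePow (w x) (τ / 2) 0))
      (StripBounded.of_svdPow U' V' u (-(τ' / 2)) τ'))
  have hx : 2 / τ ≤ 1 := by rw [div_le_one (by positivity)]; exact htr
  have key := hF.norm_le_one (fun z hz => ?_) (fun z hz => ?_) (x := 2 / τ) (by positivity) hx
  · have e1 : ((τ / 2 : ℝ) : ℂ) * ((2 / τ : ℝ) : ℂ) + ((0 : ℝ) : ℂ) = 1 := by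
      have : (τ / 2) * (2 / τ) + 0 = 1 := by field_simp; ring
      exact_mod_cast this
    have e2 : ((-(τ' / 2) : ℝ) : ℂ) * ((2 / τ : ℝ) : ℂ) + (τ' : ℂ) = 1 := by
      have : (-(τ' / 2)) * (2 / τ) + τ' = 1 := by
        have h3 : τ⁻¹ = 1 - τ'⁻¹ := by linarith
        rw [div_eq_mul_inv 2 τ, h3]
        field_simp
        ring
      exact_mod_cast this
    rw [e1, e2, svdPow_one U V hs, svdPow_one U' V' hu] at key
    simpa only [entirePow_one (hw0 _)] using key
  · refine (norm_trace_mul_le le_top (p' := 1) (by simp) _ _).trans (mul_le_one₀ ?_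
      (schatten_nonneg le_rfl _) ?_)
    · refine (schatten_mul_le_left le_top _ _).trans (mul_le_one₀ ?_ (schatten_nonneg le_top _) ?_)
      · rw [schatten_kronecker le_top]
        exact mul_le_one₀ (schatten_svdPow_le h1 ht le_top U V hs hA (by simp [hz]))
          (schatten_nonneg le_top _) schatten_top_one_le
      · rw [schatten_diagonal le_top]
        refine lpn_top_le zero_le_one fun x => ?_
        rw [abs_norm]
        refine (norm_entirePow_le (hw0 x) _).trans ?_
        simp [hz]
    · exact schatten_svdPow_le ht1' htt' le_rfl U' V' hu hC (by simp [hz, τ'])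
  · refine (norm_trace_mul_le one_le_two (p' := 2) ENNReal.inv_two_add_inv_two _ _).trans
      (mul_le_one₀ ?_ (schatten_nonneg one_le_two _) ?_)
    · refine schatten_two_kronecker_one_mul_diagonal_le _
        (schatten_svdPow_le h1 ht one_le_two U V hs hA (by simp [hz, τ]; ring)) _ fun i => ?_
      exact lpn_entirePow_le h1 ht one_le_two (fun j => hw0 (i, j)) (hw i) (by simp [hz, τ]; ring)
    · exact schatten_svdPow_le ht1' htt' one_le_two U' V' hu hC (by simp [hz, τ']; ring)

/-- For `t ≥ 2`, right multiplication of `A ⊗ 1` by a diagonal matrix whose rows have `ℓ^t` norm at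
most `1` does not increase the Schatten norm `‖A‖_t`. It holds for `t = 2` and for `t = ∞`, and
the general case follows by complex interpolation. -/
theorem schatten_kronecker_one_mul_diagonal_le {t : ℝ≥0∞} (h2 : 2 ≤ t) (A : Matrix ι ι ℂ)
    (w : ι × κ → ℂ) (hw : ∀ i, lpn t (fun j => ‖w (i, j)‖) ≤ 1) :
    schatten t ((A ⊗ₖ (1 : Matrix κ κ ℂ)) * Matrix.diagonal w) ≤ schatten t A := by
  have h1 : 1 ≤ t := one_le_two.trans h2
  by_cases ht : t = ∞
  · subst ht
    refine (schatten_mul_le_left le_top _ _).trans ?_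
    rw [schatten_kronecker le_top, mul_assoc]
    refine mul_le_of_le_one_right (schatten_nonneg le_top A) (mul_le_one₀ schatten_top_one_le
      (schatten_nonneg le_top _) ?_)
    rw [schatten_diagonal le_top]
    refine lpn_top_le zero_le_one fun x => ?_
    exact (abs_le_lpn le_top (fun j => ‖w (x.1, j)‖) x.2).trans (hw x.1)
  obtain ⟨A', hA', eA⟩ := exists_smul_schatten_le_one h1 A
  have hn := schatten_nonneg h1 A
  -- the phases of `w` form a contraction
  have hD : Matrix.diagonal w = Matrix.diagonal (fun x => ((‖w x‖ : ℝ) : ℂ)) *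
      Matrix.diagonal (fun x => w x / ((‖w x‖ : ℝ) : ℂ)) := by
    rw [Matrix.diagonal_mul_diagonal]
    congr 1; funext x
    by_cases hx : w x = 0
    · simp [hx]
    · have : ((‖w x‖ : ℝ) : ℂ) ≠ 0 := by exact_mod_cast norm_ne_zero_iff.2 hx
      field_simp
  have hP : schatten ∞ (Matrix.diagonal (fun x => w x / ((‖w x‖ : ℝ) : ℂ))) ≤ 1 := by
    rw [schatten_diagonal le_top]
    refine lpn_top_le zero_le_one fun x => ?_
    rw [abs_norm, norm_div, Complex.norm_real, norm_norm]
    exact div_self_le_one _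
  conv_lhs => rw [eA, Matrix.smul_kronecker, Matrix.smul_mul, schatten_smul h1, Complex.norm_real,
    Real.norm_eq_abs, abs_of_nonneg hn, hD, ← mul_assoc]
  refine mul_le_of_le_one_right hn ((schatten_mul_le_right h1 _ _).trans (mul_le_one₀ ?_
    (schatten_nonneg le_top _) hP))
  exact schatten_kronecker_one_mul_diagonal_le_one h2 ht hA' _ (fun x => norm_nonneg _) hw

lemma schatten_diagonal_mul_kronecker_one_le {t : ℝ≥0∞} (h2 : 2 ≤ t) (A : Matrix ι ι ℂ)
    (w : ι × κ → ℂ) (hw : ∀ i, lpn t (fun j => ‖w (i, j)‖) ≤ 1) :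
    schatten t (Matrix.diagonal w * (A ⊗ₖ (1 : Matrix κ κ ℂ))) ≤ schatten t A := by
  have h1 : 1 ≤ t := one_le_two.trans h2
  rw [← schatten_conjTranspose h1, ← schatten_conjTranspose h1 A, Matrix.conjTranspose_mul,
    Matrix.conjTranspose_kronecker, Matrix.conjTranspose_one, Matrix.diagonal_conjTranspose]
  exact schatten_kronecker_one_mul_diagonal_le h2 Aᴴ _ fun i => by simpa using hw i

end

/-! ### Exponents -/

section Exponents
variable {p q p' q' : ℝ≥0∞}

lemma rExp_comm (p q : ℝ≥0∞) : rExp p q = rExp q p := by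
  rw [rExp, rExp, max_comm, min_comm]

lemma inv_rExp_add (hpq : p ≤ q) : (rExp p q)⁻¹ + q⁻¹ = p⁻¹ := by
  have h : q⁻¹ ≤ p⁻¹ := ENNReal.inv_le_inv.2 hpq
  rw [rExp, inv_inv, max_eq_left h, min_eq_right h, tsub_add_cancel_of_le h]

lemma one_le_rExp (hp : 1 ≤ p) (hq : 1 ≤ q) : 1 ≤ rExp p q := by
  rw [rExp, ← ENNReal.inv_le_one, inv_inv]
  exact tsub_le_self.trans (max_le (ENNReal.inv_le_one.2 hp) (ENNReal.inv_le_one.2 hq))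

lemma one_le_two_mul {t : ℝ≥0∞} (h : 1 ≤ t) : 1 ≤ 2 * t :=
  one_le_mul one_le_two h

lemma one_le_two_mul_rExp (hp : 1 ≤ p) (hq : 1 ≤ q) : 1 ≤ 2 * rExp p q :=
  one_le_two_mul (one_le_rExp hp hq)

lemma rExp_self (p : ℝ≥0∞) : rExp p p = ∞ := by
  simp [rExp]

/-- Passing to conjugate exponents reverses the order. -/
lemma conj_le_conj (hp : p⁻¹ + p'⁻¹ = 1) (hq : q⁻¹ + q'⁻¹ = 1) (hq1 : 1 ≤ q)
    (hpq : p ≤ q) : q' ≤ p' := by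
  have hq0 : q⁻¹ ≠ ∞ := ENNReal.inv_ne_top.2 (by positivity)
  rw [← ENNReal.inv_le_inv]
  refine (ENNReal.add_le_add_iff_left hq0).1 ?_
  rw [hq, ← hp]
  gcongr

lemma rExp_conj_of_le (hp : p⁻¹ + p'⁻¹ = 1) (hq : q⁻¹ + q'⁻¹ = 1) (hp1 : 1 ≤ p) (hq1 : 1 ≤ q)
    (hpq : p ≤ q) : rExp p' q' = rExp p q := by
  have hqp' := conj_le_conj hp hq hq1 hpq
  have h1 := inv_rExp_add hpq
  have h2 := inv_rExp_add hqp'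
  rw [rExp_comm] at h2
  have hp0 : p⁻¹ ≠ ∞ := ENNReal.inv_ne_top.2 (by positivity)
  have hq0 : q⁻¹ ≠ ∞ := ENNReal.inv_ne_top.2 (by positivity)
  have hp0' : p'⁻¹ ≠ ∞ :=
    ENNReal.inv_ne_top.2 (zero_lt_one.trans_le (one_le_of_inv_add_inv hp)).ne'
  rw [← inv_inj]
  refine (ENNReal.add_left_inj (ENNReal.add_ne_top.2 ⟨hq0, hp0'⟩)).1 ?_
  calc (rExp p' q')⁻¹ + (q⁻¹ + p'⁻¹) = q⁻¹ + ((rExp p' q')⁻¹ + p'⁻¹) := by ring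
    _ = p⁻¹ + p'⁻¹ := by rw [h2, hq, hp]
    _ = (rExp p q)⁻¹ + (q⁻¹ + p'⁻¹) := by rw [← h1]; ring

/-- The exponent `r` is the same for `(p, q)` and for the conjugate pair. -/
lemma rExp_conj (hp : p⁻¹ + p'⁻¹ = 1) (hq : q⁻¹ + q'⁻¹ = 1) (hp1 : 1 ≤ p) (hq1 : 1 ≤ q) :
    rExp p' q' = rExp p q := by
  rcases le_total p q with h | h
  · exact rExp_conj_of_le hp hq hp1 hq1 h
  · rw [rExp_comm p', rExp_comm p]
    exact rExp_conj_of_le hq hp hq1 hp1 h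

end Exponents

section
variable {n m : ℕ} {p q p' q' : ℝ≥0∞}

lemma ampl_one : ampl m (1 : Matrix (Fin n) (Fin n) ℂ) = 1 := Matrix.one_kronecker_one

lemma schatten_ampl_mul_mul_ampl_le (h1 : 1 ≤ p) (A B : Matrix (Fin n) (Fin n) ℂ)
    (Y : Matrix (Fin n × Fin m) (Fin n × Fin m) ℂ) :
    schatten p (ampl m A * Y * ampl m B) ≤ schatten ∞ A * schatten ∞ B * schatten p Y := by
  have hampl : ∀ C : Matrix (Fin n) (Fin n) ℂ, schatten ∞ (ampl m C) ≤ schatten ∞ C := fun C => by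
    rw [ampl, schatten_kronecker le_top]
    exact mul_le_of_le_one_right (schatten_nonneg le_top C) schatten_top_one_le
  have hY := schatten_nonneg h1 Y
  have hA := schatten_nonneg le_top A
  have hA' := schatten_nonneg le_top (ampl m A)
  have hB' := schatten_nonneg le_top (ampl m B)
  calc _ ≤ schatten p (ampl m A * Y) * schatten ∞ (ampl m B) := schatten_mul_le_right h1 _ _
    _ ≤ schatten ∞ (ampl m A) * schatten p Y * schatten ∞ (ampl m B) := by
        gcongr; exact schatten_mul_le_left h1 _ _
    _ ≤ schatten ∞ A * schatten p Y * schatten ∞ B := by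
        gcongr
        · exact hampl A
        · exact hampl B
    _ = _ := by ring

/-! ### The supremum expression -/

lemma bddAbove_supSet (hp : 1 ≤ p) (hq : 1 ≤ q) (Y : Matrix (Fin n × Fin m) (Fin n × Fin m) ℂ) :
    BddAbove (supSet p q Y) := by
  have hR := one_le_two_mul_rExp hp hq
  refine ⟨schatten p Y, ?_⟩
  rintro _ ⟨A, B, hA, hB, rfl⟩
  have hA0 := schatten_pos hR hA
  have hB0 := schatten_pos hR hB
  have hY := schatten_nonneg hp Y
  have hA' := schatten_nonneg le_top A
  have hB' := schatten_nonneg le_top B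
  rw [div_le_iff₀ (mul_pos hA0 hB0)]
  calc _ ≤ schatten ∞ A * schatten ∞ B * schatten p Y := schatten_ampl_mul_mul_ampl_le hp A B Y
    _ ≤ schatten (2 * rExp p q) A * schatten (2 * rExp p q) B * schatten p Y := by
        gcongr
        · exact schatten_top_le hR A
        · exact schatten_top_le hR B
    _ = _ := mul_comm _ _

lemma ncSup_nonneg (hp : 1 ≤ p) (hq : 1 ≤ q) (Y : Matrix (Fin n × Fin m) (Fin n × Fin m) ℂ) :
    0 ≤ ncSup p q Y := by
  have hR := one_le_two_mul_rExp hp hq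
  refine Real.sSup_nonneg ?_
  rintro _ ⟨A, B, -, -, rfl⟩
  exact div_nonneg (schatten_nonneg hp _)
    (mul_nonneg (schatten_nonneg hR A) (schatten_nonneg hR B))

lemma ncSup_le (hp : 1 ≤ p) (hq : 1 ≤ q) {Y : Matrix (Fin n × Fin m) (Fin n × Fin m) ℂ} {C : ℝ}
    (hC : 0 ≤ C) (h : ∀ A B : Matrix (Fin n) (Fin n) ℂ, A ≠ 0 → B ≠ 0 →
      schatten p (ampl m A * Y * ampl m B) ≤
        C * (schatten (2 * rExp p q) A * schatten (2 * rExp p q) B)) : ncSup p q Y ≤ C := by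
  have hR := one_le_two_mul_rExp hp hq
  refine Real.sSup_le ?_ hC
  rintro _ ⟨A, B, hA, hB, rfl⟩
  rw [div_le_iff₀ (mul_pos (schatten_pos hR hA) (schatten_pos hR hB))]
  exact h A B hA hB

lemma schatten_le_ncSup_mul (hp : 1 ≤ p) (hq : 1 ≤ q)
    (Y : Matrix (Fin n × Fin m) (Fin n × Fin m) ℂ) (A B : Matrix (Fin n) (Fin n) ℂ) :
    schatten p (ampl m A * Y * ampl m B) ≤
      ncSup p q Y * (schatten (2 * rExp p q) A * schatten (2 * rExp p q) B) := by
  have hR := one_le_two_mul_rExp hp hq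
  by_cases hA : A = 0
  · subst hA
    simp [ampl, schatten_zero hp, schatten_zero hR]
  by_cases hB : B = 0
  · subst hB
    simp [ampl, schatten_zero hp, schatten_zero hR]
  rw [← div_le_iff₀ (mul_pos (schatten_pos hR hA) (schatten_pos hR hB))]
  exact le_csSup (bddAbove_supSet hp hq Y) ⟨A, B, hA, hB, rfl⟩

lemma ncSup_add_le (hp : 1 ≤ p) (hq : 1 ≤ q) (Y W : Matrix (Fin n × Fin m) (Fin n × Fin m) ℂ) :
    ncSup p q (Y + W) ≤ ncSup p q Y + ncSup p q W := by
  refine ncSup_le hp hq (add_nonneg (ncSup_nonneg hp hq Y) (ncSup_nonneg hp hq W))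
    fun A B _ _ => ?_
  rw [mul_add, add_mul, add_mul]
  exact (schatten_add_le hp _ _).trans
    (add_le_add (schatten_le_ncSup_mul hp hq Y A B) (schatten_le_ncSup_mul hp hq W A B))

lemma ncSup_self (hp : 1 ≤ p) (Y : Matrix (Fin n × Fin m) (Fin n × Fin m) ℂ) :
    ncSup p p Y = schatten p Y := by
  have hr : 2 * rExp p p = ∞ := by rw [rExp_self p]; simp
  refine le_antisymm (ncSup_le hp hp (schatten_nonneg hp Y) fun A B _ _ => ?_) ?_
  · rw [hr, mul_comm]
    exact schatten_ampl_mul_mul_ampl_le hp A B Y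
  · have := schatten_le_ncSup_mul hp hp Y 1 1
    rw [ampl_one, one_mul, mul_one, hr] at this
    exact this.trans (mul_le_of_le_one_right (ncSup_nonneg hp hp Y)
      (mul_le_one₀ schatten_top_one_le (schatten_nonneg le_top _) schatten_top_one_le))

/-! ### The infimum expression -/

lemma infSet_nonempty (p q : ℝ≥0∞) (Y : Matrix (Fin n × Fin m) (Fin n × Fin m) ℂ) :
    (infSet p q Y).Nonempty :=
  ⟨_, 1, fun _ => 1, fun _ => 1, fun _ => Y, by simp [ampl_one], rfl⟩

lemma infSet_nonneg (hp : 1 ≤ p) (hq : 1 ≤ q) {Y : Matrix (Fin n × Fin m) (Fin n × Fin m) ℂ}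
    {x : ℝ} (hx : x ∈ infSet p q Y) : 0 ≤ x := by
  have hR := one_le_two_mul_rExp hp hq
  obtain ⟨k, A, B, Z, -, rfl⟩ := hx
  exact Finset.sum_nonneg fun i _ => mul_nonneg
    (mul_nonneg (schatten_nonneg hR _) (schatten_nonneg hR _)) (schatten_nonneg hp _)

lemma ncInf_nonneg (hp : 1 ≤ p) (hq : 1 ≤ q) (Y : Matrix (Fin n × Fin m) (Fin n × Fin m) ℂ) :
    0 ≤ ncInf p q Y :=
  Real.sInf_nonneg fun _ hx => infSet_nonneg hp hq hx

lemma ncInf_le_of_mem (hp : 1 ≤ p) (hq : 1 ≤ q) {Y : Matrix (Fin n × Fin m) (Fin n × Fin m) ℂ}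
    {x : ℝ} (hx : x ∈ infSet p q Y) : ncInf p q Y ≤ x :=
  csInf_le ⟨0, fun _ hx => infSet_nonneg hp hq hx⟩ hx

lemma ncInf_ampl_mul_mul_ampl_le (hp : 1 ≤ p) (hq : 1 ≤ q) (A B : Matrix (Fin n) (Fin n) ℂ)
    (Z : Matrix (Fin n × Fin m) (Fin n × Fin m) ℂ) :
    ncInf p q (ampl m A * Z * ampl m B) ≤
      schatten (2 * rExp p q) A * schatten (2 * rExp p q) B * schatten p Z :=
  ncInf_le_of_mem hp hq ⟨1, fun _ => A, fun _ => B, fun _ => Z, by simp, by simp⟩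

lemma ncInf_add_le (hp : 1 ≤ p) (hq : 1 ≤ q) (Y W : Matrix (Fin n × Fin m) (Fin n × Fin m) ℂ) :
    ncInf p q (Y + W) ≤ ncInf p q Y + ncInf p q W := by
  refine le_of_forall_pos_le_add fun ε hε => ?_
  obtain ⟨_, ⟨k, A, B, Z, hY, rfl⟩, h1⟩ :=
    Real.lt_sInf_add_pos (infSet_nonempty p q Y) (half_pos hε)
  obtain ⟨_, ⟨l, A', B', Z', hW, rfl⟩, h2⟩ :=
    Real.lt_sInf_add_pos (infSet_nonempty p q W) (half_pos hε)
  have := ncInf_le_of_mem hp hq (Y := Y + W) ⟨k + l, Fin.append A A', Fin.append B B',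
    Fin.append Z Z', by simp only [Fin.sum_univ_add, Fin.append_left, Fin.append_right, hY, hW],
    rfl⟩
  simp only [Fin.sum_univ_add, Fin.append_left, Fin.append_right] at this
  change _ ≤ sInf _ + sInf _ + ε
  linarith

lemma ncInf_smul_le (hp : 1 ≤ p) (hq : 1 ≤ q) (c : ℂ)
    (Y : Matrix (Fin n × Fin m) (Fin n × Fin m) ℂ) :
    ncInf p q (c • Y) ≤ ‖c‖ * ncInf p q Y := by
  rw [ncInf, ncInf, ← smul_eq_mul, ← Real.sInf_smul_of_nonneg (norm_nonneg c)]
  refine le_csInf (infSet_nonempty p q Y).smul_set ?_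
  rintro _ ⟨_, ⟨k, A, B, Z, hY, rfl⟩, rfl⟩
  refine ncInf_le_of_mem hp hq ⟨k, A, B, fun i => c • Z i, ?_, ?_⟩
  · rw [hY, Finset.smul_sum]
    simp only [Matrix.mul_smul, Matrix.smul_mul]
  · simp only [schatten_smul hp, smul_eq_mul, Finset.mul_sum]
    exact Finset.sum_congr rfl fun i _ => by ring

lemma ncInf_zero (hp : 1 ≤ p) (hq : 1 ≤ q) :
    ncInf p q (0 : Matrix (Fin n × Fin m) (Fin n × Fin m) ℂ) = 0 := by
  refine le_antisymm ?_ (ncInf_nonneg hp hq 0)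
  simpa using ncInf_smul_le hp hq 0 (0 : Matrix (Fin n × Fin m) (Fin n × Fin m) ℂ)

lemma ncInf_pos_smul (hp : 1 ≤ p) (hq : 1 ≤ q) {c : ℝ} (hc : 0 < c)
    (Y : Matrix (Fin n × Fin m) (Fin n × Fin m) ℂ) :
    ncInf p q (c • Y) = c * ncInf p q Y := by
  have hle : ∀ {c : ℝ}, 0 < c → ∀ Y : Matrix (Fin n × Fin m) (Fin n × Fin m) ℂ,
      ncInf p q (c • Y) ≤ c * ncInf p q Y := fun {c} hc Y => by
    have := ncInf_smul_le hp hq (c : ℂ) Y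
    rwa [Complex.norm_real, Real.norm_eq_abs, abs_of_pos hc] at this
  refine le_antisymm (hle hc Y) ?_
  have := hle (inv_pos.2 hc) (c • Y)
  rw [inv_smul_smul₀ hc.ne'] at this
  rwa [le_inv_mul_iff₀ hc] at this

/-- A subadditive function is bounded by a multiple of `ncInf` as soon as it is so on the products
`(A ⊗ 1) Z (B ⊗ 1)`. -/
lemma le_mul_ncInf {N : Matrix (Fin n × Fin m) (Fin n × Fin m) ℂ → ℝ} {C : ℝ} (hC : 0 ≤ C)
    (h0 : N 0 ≤ 0) (hadd : ∀ Y W, N (Y + W) ≤ N Y + N W)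
    (h : ∀ A B Z, N (ampl m A * Z * ampl m B) ≤
      C * (schatten (2 * rExp p q) A * schatten (2 * rExp p q) B * schatten p Z))
    (Y : Matrix (Fin n × Fin m) (Fin n × Fin m) ℂ) : N Y ≤ C * ncInf p q Y := by
  rw [ncInf, ← smul_eq_mul, ← Real.sInf_smul_of_nonneg hC]
  refine le_csInf (infSet_nonempty p q Y).smul_set ?_
  rintro _ ⟨_, ⟨k, A, B, Z, hY, rfl⟩, rfl⟩
  simp only [smul_eq_mul, Finset.mul_sum]
  rw [hY]
  exact (Finset.le_sum_of_subadditive N h0 hadd _ _).trans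
    (Finset.sum_le_sum fun i _ => h (A i) (B i) (Z i))

lemma ncInf_self (hp : 1 ≤ p) (Y : Matrix (Fin n × Fin m) (Fin n × Fin m) ℂ) :
    ncInf p p Y = schatten p Y := by
  have hr : 2 * rExp p p = ∞ := by rw [rExp_self p]; simp
  refine le_antisymm ?_ ?_
  · have := ncInf_ampl_mul_mul_ampl_le hp hp 1 1 Y
    rw [ampl_one, one_mul, mul_one, hr] at this
    exact this.trans (mul_le_of_le_one_left (schatten_nonneg hp Y)
      (mul_le_one₀ schatten_top_one_le (schatten_nonneg le_top _) schatten_top_one_le))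
  · rw [← one_mul (ncInf p p Y)]
    refine le_mul_ncInf zero_le_one (schatten_zero hp).le (schatten_add_le hp) (fun A B Z => ?_) Y
    rw [hr, one_mul]
    exact schatten_ampl_mul_mul_ampl_le hp A B Z

/-! ### Duality between the two expressions -/

lemma trace_mul_ampl (Y Z : Matrix (Fin n × Fin m) (Fin n × Fin m) ℂ)
    (A B : Matrix (Fin n) (Fin n) ℂ) :
    (Y * (ampl m A * Z * ampl m B)).trace = (ampl m B * Y * ampl m A * Z).trace := by
  rw [← mul_assoc, Matrix.trace_mul_comm]
  simp only [mul_assoc]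

lemma norm_trace_mul_le_ncSup_mul_ncInf (hp : 1 ≤ p) (hq : 1 ≤ q) (hpp : p⁻¹ + p'⁻¹ = 1)
    (hqq : q⁻¹ + q'⁻¹ = 1) (Y W : Matrix (Fin n × Fin m) (Fin n × Fin m) ℂ) :
    ‖(Y * W).trace‖ ≤ ncSup p q Y * ncInf p' q' W := by
  refine le_mul_ncInf (N := fun W => ‖(Y * W).trace‖) (ncSup_nonneg hp hq Y) (by simp)
    (fun W₁ W₂ => ?_) (fun A B Z => ?_) W
  · rw [mul_add, Matrix.trace_add]
    exact norm_add_le _ _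
  · rw [trace_mul_ampl, rExp_conj hpp hqq hp hq]
    have hZ := schatten_nonneg (one_le_of_inv_add_inv hpp) Z
    calc _ ≤ schatten p (ampl m B * Y * ampl m A) * schatten p' Z := norm_trace_mul_le hp hpp _ _
      _ ≤ ncSup p q Y * (schatten (2 * rExp p q) B * schatten (2 * rExp p q) A) *
          schatten p' Z := by
          gcongr
          exact schatten_le_ncSup_mul hp hq Y B A
      _ = _ := by ring

lemma ncSup_le_of_forall_trace (hp : 1 ≤ p) (hq : 1 ≤ q) (hpp : p⁻¹ + p'⁻¹ = 1)
    (hqq : q⁻¹ + q'⁻¹ = 1) {Y : Matrix (Fin n × Fin m) (Fin n × Fin m) ℂ} {C : ℝ}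
    (h : ∀ W : Matrix (Fin n × Fin m) (Fin n × Fin m) ℂ,
      ncInf p' q' W ≤ 1 → ‖(Y * W).trace‖ ≤ C) : ncSup p q Y ≤ C := by
  have hp' := one_le_of_inv_add_inv hpp
  have hq' := one_le_of_inv_add_inv hqq
  have hR := one_le_two_mul_rExp hp hq
  have hC : 0 ≤ C := (norm_nonneg _).trans (h 0 (by rw [ncInf_zero hp' hq']; exact zero_le_one))
  refine ncSup_le hp hq hC fun A B hA hB => ?_
  have hA0 := schatten_pos hR hA
  have hB0 := schatten_pos hR hB
  -- `W` is the one-term product `(B ⊗ 1) Z (A ⊗ 1)`, normalised by `κ`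
  set κ := schatten (2 * rExp p q) A * schatten (2 * rExp p q) B with hκ
  have hκ0 : 0 < κ := mul_pos hA0 hB0
  have hκn : ‖((κ : ℝ) : ℂ)⁻¹‖ = κ⁻¹ := by
    rw [norm_inv, Complex.norm_real, Real.norm_eq_abs, abs_of_pos hκ0]
  refine schatten_le_of_forall_trace hp hpp fun Z hZ => ?_
  have hW := h (ampl m B * (((κ : ℝ) : ℂ)⁻¹ • Z) * ampl m A) ?_
  · rwa [trace_mul_ampl, Matrix.mul_smul, Matrix.trace_smul, norm_smul, hκn,
      inv_mul_le_iff₀ hκ0, mul_comm] at hW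
  · refine (ncInf_ampl_mul_mul_ampl_le hp' hq' _ _ _).trans ?_
    rw [rExp_conj hpp hqq hp hq, schatten_smul hp', hκn, mul_comm (schatten _ B), ← hκ,
      mul_inv_cancel_left₀ hκ0.ne']
    exact hZ

/-- By the Hahn–Banach theorem the seminorm `ncInf` is attained on its dual unit ball, and every
functional is a trace pairing. -/
lemma exists_ncSup_le_one_ncInf_le (hp : 1 ≤ p) (hq : 1 ≤ q) (hpp : p⁻¹ + p'⁻¹ = 1)
    (hqq : q⁻¹ + q'⁻¹ = 1) (Y : Matrix (Fin n × Fin m) (Fin n × Fin m) ℂ) :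
    ∃ W : Matrix (Fin n × Fin m) (Fin n × Fin m) ℂ,
      ncSup p' q' W ≤ 1 ∧ ncInf p q Y ≤ ‖(Y * W).trace‖ := by
  have hp' := one_le_of_inv_add_inv hpp
  have hq' := one_le_of_inv_add_inv hqq
  obtain ⟨g, hgY, hg⟩ : ∃ g : Matrix (Fin n × Fin m) (Fin n × Fin m) ℂ →ₗ[ℝ] ℝ,
      g Y = ncInf p q Y ∧ ∀ X, g X ≤ ncInf p q X := by
    by_cases hY : Y = 0
    · exact ⟨0, by rw [hY, ncInf_zero hp hq]; rfl, fun X => ncInf_nonneg hp hq X⟩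
    let f : Matrix (Fin n × Fin m) (Fin n × Fin m) ℂ →ₗ.[ℝ] ℝ :=
      LinearPMap.mkSpanSingleton Y (ncInf p q Y) hY
    have hle : ∀ x : f.domain, f x ≤
        ncInf p q (x : Matrix (Fin n × Fin m) (Fin n × Fin m) ℂ) := by
      rintro ⟨x, hx⟩
      obtain ⟨c, rfl⟩ := Submodule.mem_span_singleton.1 hx
      simp only [f, LinearPMap.mkSpanSingleton, LinearPMap.mkSpanSingleton'_apply]
      rcases lt_or_ge 0 c with hc | hc
      · rw [ncInf_pos_smul hp hq hc]; rfl
      · exact (mul_nonpos_of_nonpos_of_nonneg hc (ncInf_nonneg hp hq Y)).trans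
          (ncInf_nonneg hp hq _)
    obtain ⟨g, h1, h2⟩ := exists_extension_of_le_sublinear f (ncInf p q)
      (fun c hc X => ncInf_pos_smul hp hq hc X) (ncInf_add_le hp hq) hle
    refine ⟨g, ?_, h2⟩
    have := h1 ⟨Y, Submodule.mem_span_singleton_self Y⟩
    rwa [show f ⟨Y, Submodule.mem_span_singleton_self Y⟩ = ncInf p q Y from
      LinearPMap.mkSpanSingleton_apply ℝ ℝ hY _] at this
  -- the real functional `g` is the real part of the complex functional `G`
  set G : Matrix (Fin n × Fin m) (Fin n × Fin m) ℂ →ₗ[ℂ] ℂ := Module.Dual.extendRCLike g with hG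
  have hGre : ∀ X, (G X).re = g X := fun X => by
    rw [hG, Module.Dual.extendRCLike_apply]
    simp
  have hGle : ∀ X, ‖G X‖ ≤ ncInf p q X := fun X => by
    by_cases h0 : G X = 0
    · rw [h0, norm_zero]; exact ncInf_nonneg hp hq X
    -- multiplying `X` by a phase makes `G X` real
    set c : ℂ := (‖G X‖ : ℂ) / G X with hc
    have hcn : ‖c‖ = 1 := by
      rw [hc, norm_div, Complex.norm_real, norm_norm, div_self (norm_ne_zero_iff.2 h0)]
    have h1 : G (c • X) = (‖G X‖ : ℂ) := by
      rw [map_smul, smul_eq_mul, hc, div_mul_cancel₀ _ h0]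
    have h2 := hGre (c • X)
    rw [h1, Complex.ofReal_re] at h2
    rw [h2]
    refine (hg _).trans ((ncInf_smul_le hp hq c X).trans ?_)
    rw [hcn, one_mul]
  set W : Matrix (Fin n × Fin m) (Fin n × Fin m) ℂ :=
    Matrix.of fun j i => G (Matrix.single i j 1) with hW
  have hGW : ∀ X, (X * W).trace = G X := fun X => by
    conv_rhs => rw [Matrix.matrix_eq_sum_single X]
    rw [map_sum, Matrix.trace]
    refine Finset.sum_congr rfl fun i _ => ?_
    rw [Matrix.diag_apply, Matrix.mul_apply, map_sum]
    refine Finset.sum_congr rfl fun j _ => ?_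
    rw [hW, Matrix.of_apply, ← smul_eq_mul, ← map_smul, Matrix.smul_single, smul_eq_mul, mul_one]
  refine ⟨W, ncSup_le hp' hq' zero_le_one fun A B _ _ => ?_, ?_⟩
  · have hpp' : p'⁻¹ + p⁻¹ = 1 := by rw [add_comm]; exact hpp
    have hR := one_le_two_mul_rExp hp hq
    refine schatten_le_of_forall_trace hp' hpp' fun Z hZ => ?_
    rw [← trace_mul_ampl, Matrix.trace_mul_comm, hGW, one_mul, rExp_conj hpp hqq hp hq]
    refine (hGle _).trans ((ncInf_ampl_mul_mul_ampl_le hp hq B A Z).trans ?_)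
    rw [mul_comm (schatten _ A)]
    exact mul_le_of_le_one_right
      (mul_nonneg (schatten_nonneg hR _) (schatten_nonneg hR _)) hZ
  · rw [hGW, ← hgY, ← hGre]
    exact (le_abs_self _).trans (Complex.abs_re_le_norm _)

/-! ### The norm -/

lemma ncNorm_of_le (h : p ≤ q) (Y : Matrix (Fin n × Fin m) (Fin n × Fin m) ℂ) :
    ncNorm p q Y = ncSup p q Y := if_pos h

/-- The infimum expression may also be used at `p = q`. -/
lemma ncNorm_of_ge (hp : 1 ≤ p) (h : q ≤ p) (Y : Matrix (Fin n × Fin m) (Fin n × Fin m) ℂ) :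
    ncNorm p q Y = ncInf p q Y := by
  rcases h.eq_or_lt with rfl | h
  · rw [ncNorm_of_le le_rfl, ncSup_self hp, ncInf_self hp]
  · exact if_neg (not_le.2 h)

lemma ncNorm_self (hp : 1 ≤ p) (Y : Matrix (Fin n × Fin m) (Fin n × Fin m) ℂ) :
    ncNorm p p Y = schatten p Y := by
  rw [ncNorm_of_le le_rfl, ncSup_self hp]

theorem ncNorm_add_le (hp : 1 ≤ p) (hq : 1 ≤ q)
    (Y W : Matrix (Fin n × Fin m) (Fin n × Fin m) ℂ) :
    ncNorm p q (Y + W) ≤ ncNorm p q Y + ncNorm p q W := by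
  rcases le_total p q with h | h
  · simp only [ncNorm_of_le h]
    exact ncSup_add_le hp hq Y W
  · simp only [ncNorm_of_ge hp h]
    exact ncInf_add_le hp hq Y W

lemma ncNorm_nonneg (hp : 1 ≤ p) (hq : 1 ≤ q) (Y : Matrix (Fin n × Fin m) (Fin n × Fin m) ℂ) :
    0 ≤ ncNorm p q Y := by
  rcases le_total p q with h | h
  · rw [ncNorm_of_le h]
    exact ncSup_nonneg hp hq Y
  · rw [ncNorm_of_ge hp h]
    exact ncInf_nonneg hp hq Y

theorem norm_trace_mul_le_ncNorm (hp : 1 ≤ p) (hq : 1 ≤ q) (hpp : p⁻¹ + p'⁻¹ = 1)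
    (hqq : q⁻¹ + q'⁻¹ = 1) (Y W : Matrix (Fin n × Fin m) (Fin n × Fin m) ℂ) :
    ‖(Y * W).trace‖ ≤ ncNorm p q Y * ncNorm p' q' W := by
  have hp' := one_le_of_inv_add_inv hpp
  have hq' := one_le_of_inv_add_inv hqq
  rcases le_total p q with h | h
  · rw [ncNorm_of_le h, ncNorm_of_ge hp' (conj_le_conj hpp hqq hq h)]
    exact norm_trace_mul_le_ncSup_mul_ncInf hp hq hpp hqq Y W
  · rw [ncNorm_of_ge hp h, ncNorm_of_le (conj_le_conj hqq hpp hp h), Matrix.trace_mul_comm,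
      mul_comm]
    rw [add_comm] at hpp hqq
    exact norm_trace_mul_le_ncSup_mul_ncInf hp' hq' hpp hqq W Y

theorem isLUB_ncNorm (hp : 1 ≤ p) (hq : 1 ≤ q) (hpp : p⁻¹ + p'⁻¹ = 1) (hqq : q⁻¹ + q'⁻¹ = 1)
    (Y : Matrix (Fin n × Fin m) (Fin n × Fin m) ℂ) :
    IsLUB {x : ℝ | ∃ W : Matrix (Fin n × Fin m) (Fin n × Fin m) ℂ,
      ncNorm p' q' W ≤ 1 ∧ x = ‖(Y * W).trace‖} (ncNorm p q Y) := by
  have hp' := one_le_of_inv_add_inv hpp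
  have hq' := one_le_of_inv_add_inv hqq
  constructor
  · rintro _ ⟨W, hW, rfl⟩
    exact (norm_trace_mul_le_ncNorm hp hq hpp hqq Y W).trans
      (mul_le_of_le_one_right (ncNorm_nonneg hp hq Y) hW)
  · intro C hC
    rcases le_total p q with h | h
    · rw [ncNorm_of_le h]
      refine ncSup_le_of_forall_trace hp hq hpp hqq fun W hW => hC ⟨W, ?_, rfl⟩
      rwa [ncNorm_of_ge hp' (conj_le_conj hpp hqq hq h)]
    · rw [ncNorm_of_ge hp h]
      obtain ⟨W, hW, hYW⟩ := exists_ncSup_le_one_ncInf_le hp hq hpp hqq Y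
      refine hYW.trans (hC ⟨W, ?_, rfl⟩)
      rwa [ncNorm_of_le (conj_le_conj hqq hpp hp h)]

end

section
variable {n m : ℕ} {p q p' q' : ℝ≥0∞}

/-! ### Product matrices -/

lemma inv_two_mul_add_inv_two_mul (t : ℝ≥0∞) : (2 * t)⁻¹ + (2 * t)⁻¹ = t⁻¹ := by
  rw [ENNReal.mul_inv (Or.inl two_ne_zero) (Or.inl ENNReal.ofNat_ne_top), ← add_mul,
    ENNReal.inv_two_add_inv_two, one_mul]

/-- The three-factor Hölder inequality for `1/p = 1/(2r) + 1/q + 1/(2r)`. -/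
lemma schatten_mul_mul_le (hp : 1 ≤ p) (hpq : p ≤ q) {ι : Type*} [Fintype ι] [DecidableEq ι]
    (A Y B : Matrix ι ι ℂ) :
    schatten p (A * Y * B) ≤
      schatten (2 * rExp p q) A * schatten q Y * schatten (2 * rExp p q) B := by
  have hq := hp.trans hpq
  have h := inv_rExp_add hpq
  rw [← inv_two_mul_add_inv_two_mul] at h
  set R := 2 * rExp p q with hR
  have hu : 1 ≤ (R⁻¹ + q⁻¹)⁻¹ := by
    rw [← ENNReal.inv_le_one, inv_inv]
    refine le_trans ?_ (ENNReal.inv_le_one.2 hp)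
    rw [← h, add_assoc]
    exact le_add_self
  have hB := schatten_nonneg (one_le_two_mul_rExp hp hq) B
  calc schatten p (A * Y * B) ≤ schatten (R⁻¹ + q⁻¹)⁻¹ (A * Y) * schatten R B :=
        schatten_mul_le hp (by rw [inv_inv, ← h]; ring) _ _
    _ ≤ _ := by
        gcongr
        exact schatten_mul_le hu (by rw [inv_inv]) _ _

lemma exponents_add_eq_one (hp : 1 ≤ p) (hq : 1 ≤ q) (hqp : q ≤ p) (hq' : q ≠ ∞) :
    q.toReal * (2 * rExp p q)⁻¹.toReal + q.toReal * p⁻¹.toReal +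
      q.toReal * (2 * rExp p q)⁻¹.toReal = 1 := by
  have h := inv_rExp_add hqp
  rw [← inv_two_mul_add_inv_two_mul, rExp_comm] at h
  have hR : (2 * rExp p q)⁻¹ ≠ ∞ :=
    ENNReal.inv_ne_top.2 (zero_lt_one.trans_le (one_le_two_mul_rExp hp hq)).ne'
  have hp0 : p⁻¹ ≠ ∞ := ENNReal.inv_ne_top.2 (by positivity)
  have h1 := congrArg ENNReal.toReal h
  rw [ENNReal.toReal_add (ENNReal.add_ne_top.2 ⟨hR, hR⟩) hp0, ENNReal.toReal_add hR hR,
    ENNReal.toReal_inv q] at h1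
  have := one_le_toReal hq hq'
  calc _ = q.toReal * ((2 * rExp p q)⁻¹.toReal + (2 * rExp p q)⁻¹.toReal + p⁻¹.toReal) := by ring
    _ = 1 := by rw [h1, mul_inv_cancel₀ (by positivity)]

/-- The exponents in the optimal factorisation of a diagonal matrix for `q ≤ p`. -/
lemma rpow_mul_rpow_mul_rpow_eq (hp : 1 ≤ p) (hq : 1 ≤ q) (hqp : q ≤ p) (hq' : q ≠ ∞) {x : ℝ}
    (hx : 0 ≤ x) :
    x ^ (q.toReal * (2 * rExp p q)⁻¹.toReal) * x ^ (q.toReal * p⁻¹.toReal) *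
      x ^ (q.toReal * (2 * rExp p q)⁻¹.toReal) = x := by
  rw [← Real.rpow_add_of_nonneg hx (by positivity) (by positivity),
    ← Real.rpow_add_of_nonneg hx (by positivity) (by positivity),
    exponents_add_eq_one hp hq hqp hq', Real.rpow_one]

/-- The upper bound for product matrices. For `p ≤ q` it is Hölder's inequality; for `q < p` and
`Y₁ = U s V` it comes from the decomposition `Y₁ ⊗ Y₂ = (U s^α ⊗ 1) (s^β ⊗ Y₂) (s^α V ⊗ 1)`. -/
lemma ncNorm_kronecker_le (hp : 1 ≤ p) (hq : 1 ≤ q) (Y₁ : Matrix (Fin n) (Fin n) ℂ)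
    (Y₂ : Matrix (Fin m) (Fin m) ℂ) :
    ncNorm p q (Y₁ ⊗ₖ Y₂) ≤ schatten q Y₁ * schatten p Y₂ := by
  have hR := one_le_two_mul_rExp hp hq
  have h₁ := schatten_nonneg hq Y₁
  have h₂ := schatten_nonneg hp Y₂
  rcases le_or_gt p q with h | h
  · rw [ncNorm_of_le h]
    refine ncSup_le hp hq (mul_nonneg h₁ h₂) fun A B _ _ => ?_
    rw [ampl, ampl, ← Matrix.mul_kronecker_mul, ← Matrix.mul_kronecker_mul, one_mul, mul_one,
      schatten_kronecker hp]
    calc _ ≤ schatten (2 * rExp p q) A * schatten q Y₁ * schatten (2 * rExp p q) B *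
          schatten p Y₂ := by
          gcongr
          exact schatten_mul_mul_le hp h A Y₁ B
      _ = _ := by ring
  · have hq' : q ≠ ∞ := (h.trans_le le_top).ne
    rw [ncNorm_of_ge hp h.le]
    obtain ⟨U, V, s, hs, rfl⟩ := exists_svd Y₁
    rw [schatten_svd hq U V hs] at h₁ ⊢
    set α := q.toReal * (2 * rExp p q)⁻¹.toReal with hα
    set β := q.toReal * p⁻¹.toReal with hβ
    have hpow : ∀ x : ℝ, 0 ≤ x → x ^ α * x ^ β * x ^ α = x := fun x hx =>
      rpow_mul_rpow_mul_rpow_eq hp hq h.le hq' hx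
    set D : ℝ → Matrix (Fin n) (Fin n) ℂ := fun γ => Matrix.diagonal fun i => ((s i ^ γ : ℝ) : ℂ)
      with hD
    have hDn : ∀ (t : ℝ≥0∞), 1 ≤ t →
        schatten t (D (q.toReal * t⁻¹.toReal)) ≤ lpn q s ^ (q.toReal * t⁻¹.toReal) := fun t ht => by
      rw [hD, schatten_diagonal ht]
      simp only [Complex.norm_real, Real.norm_eq_abs]
      rw [lpn_abs ht]
      exact lpn_rpow_le hq hq' ht hs
    have hfac : ((U : Matrix (Fin n) (Fin n) ℂ) * Matrix.diagonal (fun i => (s i : ℂ)) *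
        (V : Matrix (Fin n) (Fin n) ℂ)) ⊗ₖ Y₂ = ampl m ((U : Matrix (Fin n) (Fin n) ℂ) * D α) *
        (D β ⊗ₖ Y₂) * ampl m (D α * (V : Matrix (Fin n) (Fin n) ℂ)) := by
      rw [ampl, ampl, ← Matrix.mul_kronecker_mul, ← Matrix.mul_kronecker_mul, one_mul, mul_one]
      congr 1
      have : Matrix.diagonal (fun i => (s i : ℂ)) = D α * D β * D α := by
        rw [hD, Matrix.diagonal_mul_diagonal, Matrix.diagonal_mul_diagonal]
        congr 1; funext i
        rw [← Complex.ofReal_mul, ← Complex.ofReal_mul, hpow _ (hs i)]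
      rw [this]
      simp only [mul_assoc]
    rw [hfac]
    refine (ncInf_ampl_mul_mul_ampl_le hp hq _ _ _).trans ?_
    rw [schatten_unitary_mul hR, schatten_mul_unitary hR, schatten_kronecker hp, ← mul_assoc]
    refine mul_le_mul_of_nonneg_right ?_ h₂
    have e1 := hDn _ hR
    have e2 := hDn _ hp
    have f1 := schatten_nonneg hR (D α)
    have f2 := schatten_nonneg hp (D β)
    calc schatten (2 * rExp p q) (D α) * schatten (2 * rExp p q) (D α) * schatten p (D β) ≤
          lpn q s ^ α * lpn q s ^ α * lpn q s ^ β := by gcongr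
      _ = lpn q s ^ α * lpn q s ^ β * lpn q s ^ α := by ring
      _ = lpn q s := hpow _ h₁

/-- A lower bound for the norm of `Y` from a matrix `W` in the dual unit ball. -/
lemma le_ncNorm_of_trace (hp : 1 ≤ p) (hq : 1 ≤ q) (hpp : p⁻¹ + p'⁻¹ = 1) (hqq : q⁻¹ + q'⁻¹ = 1)
    {Y W : Matrix (Fin n × Fin m) (Fin n × Fin m) ℂ} {C : ℝ} (hW : ncNorm p' q' W ≤ 1)
    (h : (Y * W).trace = (C : ℂ)) : C ≤ ncNorm p q Y := by
  have h1 := norm_trace_mul_le_ncNorm hp hq hpp hqq Y W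
  rw [h, Complex.norm_real, Real.norm_eq_abs] at h1
  exact (le_abs_self C).trans (h1.trans (mul_le_of_le_one_right (ncNorm_nonneg hp hq Y) hW))

theorem ncNorm_kronecker (hp : 1 ≤ p) (hq : 1 ≤ q) (Y₁ : Matrix (Fin n) (Fin n) ℂ)
    (Y₂ : Matrix (Fin m) (Fin m) ℂ) :
    ncNorm p q (Y₁ ⊗ₖ Y₂) = schatten q Y₁ * schatten p Y₂ := by
  refine le_antisymm (ncNorm_kronecker_le hp hq Y₁ Y₂) ?_
  obtain ⟨p', hpp⟩ := exists_inv_add_inv hp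
  obtain ⟨q', hqq⟩ := exists_inv_add_inv hq
  have hp' := one_le_of_inv_add_inv hpp
  have hq' := one_le_of_inv_add_inv hqq
  obtain ⟨W₁, hW₁, e₁⟩ := exists_trace_mul_eq_schatten hq hqq Y₁
  obtain ⟨W₂, hW₂, e₂⟩ := exists_trace_mul_eq_schatten hp hpp Y₂
  refine le_ncNorm_of_trace hp hq hpp hqq (W := W₁ ⊗ₖ W₂) ((ncNorm_kronecker_le hp' hq' _ _).trans
    (mul_le_one₀ hW₁ (schatten_nonneg hp' _) hW₂)) ?_
  rw [← Matrix.mul_kronecker_mul, Matrix.trace_kronecker, e₁, e₂]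
  push_cast; rfl

/-! ### Matrices that are diagonal in a product basis -/

/-- The matrix `(E ⊗ F) diag(y) (E ⊗ F)*`. -/
noncomputable def prodConjDiag (E : Matrix.unitaryGroup (Fin n) ℂ)
    (F : Matrix.unitaryGroup (Fin m) ℂ) (y : Fin n → Fin m → ℂ) :
    Matrix (Fin n × Fin m) (Fin n × Fin m) ℂ :=
  conjDiag ⟨_, kronecker_mem_unitaryGroup E F⟩ fun x => y x.1 x.2

lemma prodConjDiag_apply (E : Matrix.unitaryGroup (Fin n) ℂ) (F : Matrix.unitaryGroup (Fin m) ℂ)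
    (y : Fin n → Fin m → ℂ) :
    prodConjDiag E F y = ((E : Matrix (Fin n) (Fin n) ℂ) ⊗ₖ (F : Matrix (Fin m) (Fin m) ℂ)) *
      Matrix.diagonal (fun x : Fin n × Fin m => y x.1 x.2) *
      ((star (E : Matrix (Fin n) (Fin n) ℂ)) ⊗ₖ (star (F : Matrix (Fin m) (Fin m) ℂ))) := by
  rw [prodConjDiag, conjDiag_apply]
  simp only [Matrix.star_eq_conjTranspose, Matrix.conjTranspose_kronecker]

lemma norm_toLp_eq_lpn {ι : Type*} [Fintype ι] {t : ℝ≥0∞} (h1 : 1 ≤ t) {E : Type*}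
    [SeminormedAddCommGroup E] (s : ι → E) : ‖WithLp.toLp t s‖ = lpn t (fun i => ‖s i‖) := by
  by_cases ht : t = ∞
  · subst ht
    rw [PiLp.norm_eq_ciSup, lpn, PiLp.norm_eq_ciSup]
    simp
  · rw [PiLp.norm_eq_sum (ENNReal.toReal_pos (by positivity) ht), lpn_of_ne_top h1 ht]
    simp

lemma mixedNorm_eq (hp : 1 ≤ p) (hq : 1 ≤ q) (y : Fin n → Fin m → ℂ) :
    mixedNorm p q y = lpn q (fun i => lpn p (fun j => ‖y i j‖)) := by
  rw [mixedNorm, norm_toLp_eq_lpn hq]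
  congr 1; funext i
  rw [norm_toLp_eq_lpn hp, Real.norm_eq_abs, abs_of_nonneg (lpn_nonneg hp _)]

lemma lpn_two_mul_sqrt_le {ι : Type*} [Fintype ι] {t : ℝ≥0∞} (h1 : 1 ≤ t) {s : ι → ℝ}
    (hs : ∀ i, 0 ≤ s i) : lpn (2 * t) (fun i => √(s i)) ≤ √(lpn t s) := by
  by_cases ht : t = ∞
  · subst ht
    rw [ENNReal.mul_top two_ne_zero]
    refine lpn_top_le (Real.sqrt_nonneg _) fun i => ?_
    rw [abs_of_nonneg (Real.sqrt_nonneg _)]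
    exact Real.sqrt_le_sqrt ((le_abs_self _).trans (abs_le_lpn le_top s i))
  · have h := lpn_rpow_le h1 ht (one_le_two_mul h1) hs
    have e : t.toReal * (2 * t)⁻¹.toReal = 1 / 2 := by
      have := one_le_toReal h1 ht
      rw [ENNReal.toReal_inv, ENNReal.toReal_mul, ENNReal.toReal_ofNat]
      field_simp
    simpa only [e, ← Real.sqrt_eq_rpow] using h

/-- The upper bound for a diagonal matrix and `p ≤ q`. -/
lemma schatten_ampl_mul_diagonal_mul_ampl_le (hp : 1 ≤ p) (hpq : p ≤ q)
    (y : Fin n → Fin m → ℂ) (A B : Matrix (Fin n) (Fin n) ℂ) :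
    schatten p (ampl m A * Matrix.diagonal (fun x : Fin n × Fin m => y x.1 x.2) * ampl m B) ≤
      mixedNorm p q y * (schatten (2 * rExp p q) A * schatten (2 * rExp p q) B) := by
  have hq := hp.trans hpq
  have hR := one_le_two_mul_rExp hp hq
  rw [mixedNorm_eq hp hq]
  set c : Fin n → ℝ := fun i => lpn p (fun j => ‖y i j‖) with hc
  have hc0 : ∀ i, 0 ≤ c i := fun i => lpn_nonneg hp _
  have hyc : ∀ i j, ‖y i j‖ ≤ c i := fun i j => by
    have := abs_le_lpn hp (fun j => ‖y i j‖) j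
    rwa [abs_norm] at this
  -- `y i j = √(c i) * w₁ i j * w₂ i j * √(c i)`, where `|w₁| = |w₂|` have rows of norm at most `1`
  set w₁ : Fin n × Fin m → ℂ := fun x => ((√(‖y x.1 x.2‖ / c x.1) : ℝ) : ℂ) with hw₁
  set w₂ : Fin n × Fin m → ℂ := fun x =>
    y x.1 x.2 / ‖y x.1 x.2‖ * ((√(‖y x.1 x.2‖ / c x.1) : ℝ) : ℂ) with hw₂
  have hn₁ : ∀ i, lpn (2 * p) (fun j => ‖w₁ (i, j)‖) ≤ 1 := fun i => by
    have h1 : ∀ j, ‖w₁ (i, j)‖ = √((c i)⁻¹ * ‖y i j‖) := fun j => by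
      rw [hw₁, Complex.norm_real, Real.norm_eq_abs, abs_of_nonneg (Real.sqrt_nonneg _),
        div_eq_inv_mul]
    simp only [h1]
    refine (lpn_two_mul_sqrt_le hp fun j =>
      mul_nonneg (inv_nonneg.2 (hc0 i)) (norm_nonneg _)).trans ?_
    rw [lpn_const_mul hp, Real.sqrt_le_one, abs_of_nonneg (inv_nonneg.2 (hc0 i))]
    exact inv_mul_le_one
  have hn₂ : ∀ i, lpn (2 * p) (fun j => ‖w₂ (i, j)‖) ≤ 1 := fun i => by
    refine (lpn_mono (one_le_two_mul hp) fun j => ?_).trans (hn₁ i)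
    rw [abs_norm, abs_norm, hw₂, norm_mul, norm_div, Complex.norm_real, norm_norm]
    exact mul_le_of_le_one_left (norm_nonneg _) (div_self_le_one _)
  set C : Matrix (Fin n) (Fin n) ℂ := Matrix.diagonal fun i => ((√(c i) : ℝ) : ℂ) with hC
  have hCn : schatten (2 * q) C * schatten (2 * q) C ≤ lpn q c := by
    have h1 : schatten (2 * q) C ≤ √(lpn q c) := by
      rw [hC, schatten_diagonal (one_le_two_mul hq)]
      simp only [Complex.norm_real, Real.norm_eq_abs]
      rw [lpn_abs (one_le_two_mul hq)]
      exact lpn_two_mul_sqrt_le hq hc0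
    have h2 := schatten_nonneg (one_le_two_mul hq) C
    calc _ ≤ √(lpn q c) * √(lpn q c) := by gcongr
      _ = _ := Real.mul_self_sqrt (lpn_nonneg hq c)
  have hampl : ampl m C = Matrix.diagonal (fun x : Fin n × Fin m => ((√(c x.1) : ℝ) : ℂ)) := by
    rw [ampl, hC, ← Matrix.diagonal_one, Matrix.diagonal_kronecker_diagonal]
    simp
  have hfac : Matrix.diagonal (fun x : Fin n × Fin m => y x.1 x.2) =
      ampl m C * Matrix.diagonal w₁ * (Matrix.diagonal w₂ * ampl m C) := by
    rw [hampl, Matrix.diagonal_mul_diagonal, Matrix.diagonal_mul_diagonal,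
      Matrix.diagonal_mul_diagonal]
    congr 1; funext x
    by_cases hy : y x.1 x.2 = 0
    · simp [hy, hw₂]
    have hpos : 0 < ‖y x.1 x.2‖ := norm_pos_iff.2 hy
    have hcpos : 0 < c x.1 := hpos.trans_le (hyc _ _)
    have h1 : ((√(c x.1) : ℝ) : ℂ) * ((√(c x.1) : ℝ) : ℂ) = (c x.1 : ℂ) := by
      rw [← Complex.ofReal_mul, Real.mul_self_sqrt hcpos.le]
    have h2 : ((√(‖y x.1 x.2‖ / c x.1) : ℝ) : ℂ) * ((√(‖y x.1 x.2‖ / c x.1) : ℝ) : ℂ) =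
        (‖y x.1 x.2‖ : ℂ) / (c x.1 : ℂ) := by
      rw [← Complex.ofReal_mul, Real.mul_self_sqrt (by positivity), Complex.ofReal_div]
    have h3 : (c x.1 : ℂ) ≠ 0 := by exact_mod_cast hcpos.ne'
    have h4 : (‖y x.1 x.2‖ : ℂ) ≠ 0 := by exact_mod_cast hpos.ne'
    calc y x.1 x.2 = (c x.1 : ℂ) * ((‖y x.1 x.2‖ : ℂ) / (c x.1 : ℂ)) *
          (y x.1 x.2 / ‖y x.1 x.2‖) := by field_simp
      _ = (((√(c x.1) : ℝ) : ℂ) * ((√(c x.1) : ℝ) : ℂ)) *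
          (((√(‖y x.1 x.2‖ / c x.1) : ℝ) : ℂ) * ((√(‖y x.1 x.2‖ / c x.1) : ℝ) : ℂ)) *
          (y x.1 x.2 / ‖y x.1 x.2‖) := by rw [h1, h2]
      _ = _ := by simp only [hw₁, hw₂]; ring
  have hmul : ∀ X Z : Matrix (Fin n) (Fin n) ℂ, ampl m X * ampl m Z = ampl m (X * Z) :=
    fun X Z => by rw [ampl, ampl, ampl, ← Matrix.mul_kronecker_mul, one_mul]
  have h2p : 1 ≤ 2 * p := one_le_two_mul hp
  have h22p : 2 ≤ 2 * p := le_mul_of_one_le_right' hp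
  have hexp : (2 * p)⁻¹ = (2 * rExp p q)⁻¹ + (2 * q)⁻¹ := by
    have h2 : ∀ t : ℝ≥0∞, (2 * t)⁻¹ = 2⁻¹ * t⁻¹ := fun t =>
      ENNReal.mul_inv (Or.inl two_ne_zero) (Or.inl ENNReal.ofNat_ne_top)
    rw [h2, h2, h2, ← mul_add, inv_rExp_add hpq]
  have hAC : schatten (2 * p) (A * C) ≤ schatten (2 * rExp p q) A * schatten (2 * q) C :=
    schatten_mul_le h2p hexp A C
  have hCB : schatten (2 * p) (C * B) ≤ schatten (2 * q) C * schatten (2 * rExp p q) B :=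
    schatten_mul_le h2p (by rw [add_comm]; exact hexp) C B
  have hl : schatten (2 * p) (ampl m (A * C) * Matrix.diagonal w₁) ≤ schatten (2 * p) (A * C) :=
    schatten_kronecker_one_mul_diagonal_le h22p (A * C) w₁ hn₁
  have hr : schatten (2 * p) (Matrix.diagonal w₂ * ampl m (C * B)) ≤ schatten (2 * p) (C * B) :=
    schatten_diagonal_mul_kronecker_one_le h22p (C * B) w₂ hn₂
  have hA0 := schatten_nonneg hR A
  have hB0 := schatten_nonneg hR B
  have hCB0 := schatten_nonneg h2p (C * B)
  have hC0 := schatten_nonneg (one_le_two_mul hq) C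
  have hx := schatten_nonneg h2p (Matrix.diagonal w₂ * ampl m (C * B))
  have hy := schatten_nonneg h2p (A * C)
  calc _ = schatten p ((ampl m (A * C) * Matrix.diagonal w₁) *
        (Matrix.diagonal w₂ * ampl m (C * B))) := by
        rw [hfac, ← hmul, ← hmul]; simp only [mul_assoc]
    _ ≤ schatten (2 * p) (ampl m (A * C) * Matrix.diagonal w₁) *
        schatten (2 * p) (Matrix.diagonal w₂ * ampl m (C * B)) :=
        schatten_mul_le hp (inv_two_mul_add_inv_two_mul p).symm _ _
    _ ≤ schatten (2 * p) (A * C) * schatten (2 * p) (C * B) := mul_le_mul hl hr hx hy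
    _ ≤ (schatten (2 * rExp p q) A * schatten (2 * q) C) *
        (schatten (2 * q) C * schatten (2 * rExp p q) B) :=
        mul_le_mul hAC hCB hCB0 (mul_nonneg hA0 hC0)
    _ = (schatten (2 * q) C * schatten (2 * q) C) *
        (schatten (2 * rExp p q) A * schatten (2 * rExp p q) B) := by ring
    _ ≤ _ := mul_le_mul_of_nonneg_right hCn (mul_nonneg hA0 hB0)

lemma ampl_mul_kronecker (A : Matrix (Fin n) (Fin n) ℂ) (E : Matrix (Fin n) (Fin n) ℂ)
    (F : Matrix (Fin m) (Fin m) ℂ) :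
    ampl m A * (E ⊗ₖ F) = ((1 : Matrix (Fin n) (Fin n) ℂ) ⊗ₖ F) * ampl m (A * E) := by
  rw [ampl, ampl, ← Matrix.mul_kronecker_mul, ← Matrix.mul_kronecker_mul]
  simp only [one_mul, mul_one]

lemma kronecker_mul_ampl (A : Matrix (Fin n) (Fin n) ℂ) (E : Matrix (Fin n) (Fin n) ℂ)
    (F : Matrix (Fin m) (Fin m) ℂ) :
    (E ⊗ₖ F) * ampl m A = ampl m (E * A) * ((1 : Matrix (Fin n) (Fin n) ℂ) ⊗ₖ F) := by
  rw [ampl, ampl, ← Matrix.mul_kronecker_mul, ← Matrix.mul_kronecker_mul]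
  simp only [one_mul, mul_one]

/-- The upper bound for matrices that are diagonal in a product basis. The unitary `1 ⊗ F` commutes
with `A ⊗ 1` and leaves the Schatten norms invariant, while `E` is absorbed by `A` and `B`. -/
lemma ncNorm_prodConjDiag_le (hp : 1 ≤ p) (hq : 1 ≤ q) (E : Matrix.unitaryGroup (Fin n) ℂ)
    (F : Matrix.unitaryGroup (Fin m) ℂ) (y : Fin n → Fin m → ℂ) :
    ncNorm p q (prodConjDiag E F y) ≤ mixedNorm p q y := by
  have hR := one_le_two_mul_rExp hp hq
  have hM : 0 ≤ mixedNorm p q y := by rw [mixedNorm_eq hp hq]; exact lpn_nonneg hq _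
  let G : Matrix.unitaryGroup (Fin n × Fin m) ℂ := ⟨_, kronecker_mem_unitaryGroup 1 F⟩
  have hG : (G : Matrix (Fin n × Fin m) (Fin n × Fin m) ℂ) =
      (1 : Matrix (Fin n) (Fin n) ℂ) ⊗ₖ (F : Matrix (Fin m) (Fin m) ℂ) := rfl
  have hG' : ((star G : Matrix.unitaryGroup (Fin n × Fin m) ℂ) :
      Matrix (Fin n × Fin m) (Fin n × Fin m) ℂ) =
      (1 : Matrix (Fin n) (Fin n) ℂ) ⊗ₖ star (F : Matrix (Fin m) (Fin m) ℂ) := by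
    rw [Unitary.coe_star, hG, Matrix.star_eq_conjTranspose, Matrix.conjTranspose_kronecker,
      Matrix.conjTranspose_one, Matrix.star_eq_conjTranspose]
  rcases le_or_gt p q with h | h
  · rw [ncNorm_of_le h]
    refine ncSup_le hp hq hM fun A B _ _ => ?_
    have h1 : ampl m A * prodConjDiag E F y * ampl m B =
        (G : Matrix (Fin n × Fin m) (Fin n × Fin m) ℂ) *
        (ampl m (A * (E : Matrix (Fin n) (Fin n) ℂ)) *
        Matrix.diagonal (fun x : Fin n × Fin m => y x.1 x.2) *
        ampl m (star (E : Matrix (Fin n) (Fin n) ℂ) * B)) *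
        ((star G : Matrix.unitaryGroup (Fin n × Fin m) ℂ) :
          Matrix (Fin n × Fin m) (Fin n × Fin m) ℂ) := by
      rw [prodConjDiag_apply, hG', hG]
      calc _ = (ampl m A * ((E : Matrix (Fin n) (Fin n) ℂ) ⊗ₖ (F : Matrix (Fin m) (Fin m) ℂ))) *
            Matrix.diagonal (fun x : Fin n × Fin m => y x.1 x.2) *
            ((star (E : Matrix (Fin n) (Fin n) ℂ) ⊗ₖ star (F : Matrix (Fin m) (Fin m) ℂ)) *
              ampl m B) := by simp only [mul_assoc]
        _ = _ := by
            rw [ampl_mul_kronecker, kronecker_mul_ampl B]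
            simp only [mul_assoc]
    rw [h1, schatten_mul_unitary hp, schatten_unitary_mul hp]
    refine (schatten_ampl_mul_diagonal_mul_ampl_le hp h y _ _).trans ?_
    rw [schatten_mul_unitary hR, ← Unitary.coe_star, schatten_unitary_mul hR]
  · have hq' : q ≠ ∞ := (h.trans_le le_top).ne
    rw [ncNorm_of_ge hp h.le]
    rw [mixedNorm_eq hp hq] at hM ⊢
    set c : Fin n → ℝ := fun i => lpn p (fun j => ‖y i j‖) with hc
    have hc0 : ∀ i, 0 ≤ c i := fun i => lpn_nonneg hp _
    have hyc : ∀ i j, ‖y i j‖ ≤ c i := fun i j => by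
      have := abs_le_lpn hp (fun j => ‖y i j‖) j
      rwa [abs_norm] at this
    set α := q.toReal * (2 * rExp p q)⁻¹.toReal with hα
    set β := q.toReal * p⁻¹.toReal with hβ
    have hpow : ∀ x : ℝ, 0 ≤ x → x ^ α * x ^ β * x ^ α = x := fun x hx =>
      rpow_mul_rpow_mul_rpow_eq hp hq h.le hq' hx
    -- `diag(y) = (D ⊗ 1) diag(z) (D ⊗ 1)` with `D = diag(c^α)`, and the rows of `z` have norm `c^β`
    set D : Matrix (Fin n) (Fin n) ℂ := Matrix.diagonal fun i => ((c i ^ α : ℝ) : ℂ) with hD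
    set z : Fin n × Fin m → ℂ := fun x =>
      ((c x.1 ^ β : ℝ) : ℂ) * (((c x.1)⁻¹ : ℝ) : ℂ) * y x.1 x.2 with hz
    have hDn : schatten (2 * rExp p q) D ≤ lpn q c ^ α := by
      rw [hD, schatten_diagonal hR]
      simp only [Complex.norm_real, Real.norm_eq_abs]
      rw [lpn_abs hR]
      exact lpn_rpow_le hq hq' hR hc0
    have hzn : schatten p (Matrix.diagonal z) ≤ lpn q c ^ β := by
      rw [schatten_diagonal hp, lpn_prod hp]
      refine le_trans (lpn_mono hp fun i => ?_) (lpn_rpow_le hq hq' hp hc0)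
      rw [abs_of_nonneg (lpn_nonneg hp _), abs_of_nonneg (Real.rpow_nonneg (hc0 i) _)]
      simp only [hz, norm_mul, Complex.norm_real, Real.norm_eq_abs]
      rw [lpn_const_mul hp, abs_mul, abs_abs, abs_abs, abs_of_nonneg (Real.rpow_nonneg (hc0 i) _),
        abs_of_nonneg (inv_nonneg.2 (hc0 i)), mul_assoc]
      exact mul_le_of_le_one_right (Real.rpow_nonneg (hc0 i) _) inv_mul_le_one
    have hampl : ampl m D = Matrix.diagonal (fun x : Fin n × Fin m => ((c x.1 ^ α : ℝ) : ℂ)) := by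
      rw [ampl, hD, ← Matrix.diagonal_one, Matrix.diagonal_kronecker_diagonal]
      simp
    have hdiag : Matrix.diagonal (fun x : Fin n × Fin m => y x.1 x.2) =
        ampl m D * Matrix.diagonal z * ampl m D := by
      rw [hampl, Matrix.diagonal_mul_diagonal, Matrix.diagonal_mul_diagonal]
      congr 1; funext x
      by_cases hy : y x.1 x.2 = 0
      · simp [hy, hz]
      have hcpos : 0 < c x.1 := (norm_pos_iff.2 hy).trans_le (hyc _ _)
      have h3 : (c x.1 : ℂ) ≠ 0 := by exact_mod_cast hcpos.ne'
      have h4 : ((c x.1 ^ α : ℝ) : ℂ) * ((c x.1 ^ β : ℝ) : ℂ) * ((c x.1 ^ α : ℝ) : ℂ) =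
          (c x.1 : ℂ) := by
        rw [← Complex.ofReal_mul, ← Complex.ofReal_mul, hpow _ (hc0 _)]
      calc y x.1 x.2 = (c x.1 : ℂ) * (c x.1 : ℂ)⁻¹ * y x.1 x.2 := by
            rw [mul_inv_cancel₀ h3, one_mul]
        _ = ((c x.1 ^ α : ℝ) : ℂ) * ((c x.1 ^ β : ℝ) : ℂ) * ((c x.1 ^ α : ℝ) : ℂ) *
            (c x.1 : ℂ)⁻¹ * y x.1 x.2 := by rw [h4]
        _ = _ := by simp only [hz, Complex.ofReal_inv]; ring
    have hfac : prodConjDiag E F y = ampl m ((E : Matrix (Fin n) (Fin n) ℂ) * D) *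
        ((G : Matrix (Fin n × Fin m) (Fin n × Fin m) ℂ) * Matrix.diagonal z *
        ((star G : Matrix.unitaryGroup (Fin n × Fin m) ℂ) :
          Matrix (Fin n × Fin m) (Fin n × Fin m) ℂ)) *
        ampl m (D * star (E : Matrix (Fin n) (Fin n) ℂ)) := by
      rw [prodConjDiag_apply, hG', hG, hdiag]
      calc _ = (((E : Matrix (Fin n) (Fin n) ℂ) ⊗ₖ (F : Matrix (Fin m) (Fin m) ℂ)) * ampl m D) *
            Matrix.diagonal z * (ampl m D *
              (star (E : Matrix (Fin n) (Fin n) ℂ) ⊗ₖ star (F : Matrix (Fin m) (Fin m) ℂ))) := by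
            simp only [mul_assoc]
        _ = _ := by
            rw [ampl_mul_kronecker, kronecker_mul_ampl]
            simp only [mul_assoc]
    rw [hfac]
    refine (ncInf_ampl_mul_mul_ampl_le hp hq _ _ _).trans ?_
    rw [schatten_unitary_mul hR, ← Unitary.coe_star, schatten_mul_unitary hR,
      schatten_mul_unitary hp, schatten_unitary_mul hp]
    have f1 := schatten_nonneg hR D
    have f2 := schatten_nonneg hp (Matrix.diagonal z)
    calc _ ≤ lpn q c ^ α * lpn q c ^ α * lpn q c ^ β := by gcongr
      _ = lpn q c ^ α * lpn q c ^ β * lpn q c ^ α := by ring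
      _ = lpn q c := hpow _ hM

/-- The duality of the classical mixed norms. -/
lemma exists_mixedNorm_le_one_sum_eq (hp : 1 ≤ p) (hq : 1 ≤ q) (hpp : p⁻¹ + p'⁻¹ = 1)
    (hqq : q⁻¹ + q'⁻¹ = 1) (y : Fin n → Fin m → ℂ) :
    ∃ w : Fin n → Fin m → ℂ, mixedNorm p' q' w ≤ 1 ∧
      ∑ i, ∑ j, y i j * w i j = (mixedNorm p q y : ℂ) := by
  have hp' := one_le_of_inv_add_inv hpp
  have hq' := one_le_of_inv_add_inv hqq
  choose u hu0 hu1 hu using fun i =>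
    exists_sum_mul_eq_lpn hp hpp (fun j => ‖y i j‖) (fun j => norm_nonneg _)
  obtain ⟨d, hd0, hd1, hd⟩ := exists_sum_mul_eq_lpn hq hqq
    (fun i => lpn p (fun j => ‖y i j‖)) (fun i => lpn_nonneg hp _)
  have hph : ∀ i j, ∃ ω : ℂ, ‖ω‖ ≤ 1 ∧ y i j * ω = (‖y i j‖ : ℂ) := fun i j => by
    by_cases h : y i j = 0
    · exact ⟨0, by simp, by simp [h]⟩
    · refine ⟨(‖y i j‖ : ℂ) / y i j, ?_, mul_div_cancel₀ _ h⟩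
      rw [norm_div, Complex.norm_real, norm_norm]
      exact div_self_le_one _
  choose ω hω1 hω using hph
  refine ⟨fun i j => (d i : ℂ) * (u i j : ℂ) * ω i j, ?_, ?_⟩
  · rw [mixedNorm_eq hp' hq']
    refine (lpn_mono hq' fun i => ?_).trans hd1
    rw [abs_of_nonneg (lpn_nonneg hp' _), abs_of_nonneg (hd0 i)]
    have h1 : lpn p' (fun j => ‖(d i : ℂ) * (u i j : ℂ) * ω i j‖) ≤
        lpn p' (fun j => d i * u i j) := lpn_mono hp' fun j => by
      rw [abs_norm, norm_mul, norm_mul, Complex.norm_real, Complex.norm_real, Real.norm_eq_abs,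
        Real.norm_eq_abs, abs_mul]
      exact mul_le_of_le_one_right (by positivity) (hω1 i j)
    refine h1.trans ?_
    rw [lpn_const_mul hp', abs_of_nonneg (hd0 i)]
    exact mul_le_of_le_one_right (hd0 i) (hu1 i)
  · rw [mixedNorm_eq hp hq, ← hd]
    push_cast
    refine Finset.sum_congr rfl fun i _ => ?_
    rw [← hu i]
    push_cast
    rw [Finset.sum_mul]
    refine Finset.sum_congr rfl fun j _ => ?_
    rw [← hω i j]; ring

theorem ncNorm_prodConjDiag (hp : 1 ≤ p) (hq : 1 ≤ q) (E : Matrix.unitaryGroup (Fin n) ℂ)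
    (F : Matrix.unitaryGroup (Fin m) ℂ) (y : Fin n → Fin m → ℂ) :
    ncNorm p q (prodConjDiag E F y) = mixedNorm p q y := by
  refine le_antisymm (ncNorm_prodConjDiag_le hp hq E F y) ?_
  obtain ⟨p', hpp⟩ := exists_inv_add_inv hp
  obtain ⟨q', hqq⟩ := exists_inv_add_inv hq
  obtain ⟨w, hw, e⟩ := exists_mixedNorm_le_one_sum_eq hp hq hpp hqq y
  refine le_ncNorm_of_trace hp hq hpp hqq (W := prodConjDiag E F w)
    ((ncNorm_prodConjDiag_le (one_le_of_inv_add_inv hpp) (one_le_of_inv_add_inv hqq) E F w).trans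
      hw) ?_
  rw [prodConjDiag, prodConjDiag, ← map_mul, trace_conjDiag, ← e, Fintype.sum_prod_type]
  rfl

lemma partialTrace₂_prodConjDiag (E : Matrix.unitaryGroup (Fin n) ℂ)
    (F : Matrix.unitaryGroup (Fin m) ℂ) (y : Fin n → Fin m → ℂ) :
    partialTrace₂ (prodConjDiag E F y) = conjDiag E (fun i => ∑ j, y i j) := by
  ext i i'
  rw [partialTrace₂, Matrix.of_apply, prodConjDiag_apply, conjDiag_apply, Matrix.mul_apply]
  have hF : ∀ b, ∑ j, (F : Matrix (Fin m) (Fin m) ℂ) j b *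
      star ((F : Matrix (Fin m) (Fin m) ℂ) j b) = 1 := fun b => by
    have h := congrFun (congrFun (Matrix.mem_unitaryGroup_iff'.1 F.2) b) b
    rw [Matrix.mul_apply, Matrix.one_apply_eq] at h
    rw [← h]
    exact Finset.sum_congr rfl fun j _ => mul_comm _ _
  simp only [Matrix.mul_apply (M := _ * Matrix.diagonal _), Matrix.mul_diagonal,
    Matrix.kroneckerMap_apply, Matrix.star_apply, Fintype.sum_prod_type]
  rw [Finset.sum_comm]
  refine Finset.sum_congr rfl fun a _ => ?_
  rw [Finset.sum_comm, Finset.mul_sum, Finset.sum_mul]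
  refine Finset.sum_congr rfl fun b _ => ?_
  calc _ = (E : Matrix (Fin n) (Fin n) ℂ) i a * y a b * star ((E : Matrix (Fin n) (Fin n) ℂ) i' a) *
        ∑ j, (F : Matrix (Fin m) (Fin m) ℂ) j b * star ((F : Matrix (Fin m) (Fin m) ℂ) j b) := by
        rw [Finset.mul_sum]
        exact Finset.sum_congr rfl fun j _ => by ring
    _ = _ := by rw [hF, mul_one]

theorem tracePQ_prodConjDiag (hp : 1 ≤ p) (hq : 1 ≤ q) (hp' : p ≠ ∞) (hq' : q ≠ ∞)
    (E : Matrix.unitaryGroup (Fin n) ℂ) (F : Matrix.unitaryGroup (Fin m) ℂ)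
    (y : Fin n → Fin m → ℂ) :
    tracePQ p.toReal q.toReal (prodConjDiag E F y) = mixedNorm p q y := by
  have h1 := one_le_toReal hp hp'
  have habs : CFC.abs (prodConjDiag E F y) = prodConjDiag E F (fun i j => ((‖y i j‖ : ℝ) : ℂ)) := by
    rw [prodConjDiag, conjDiag_apply, ← Unitary.coe_star, abs_mul_diagonal_mul, star_star]
    rfl
  have hpow : (prodConjDiag E F (fun i j => ((‖y i j‖ : ℝ) : ℂ))) ^ p.toReal =
      prodConjDiag E F (fun i j => ((‖y i j‖ ^ p.toReal : ℝ) : ℂ)) :=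
    conjDiag_rpow _ (fun x : Fin n × Fin m => ‖y x.1 x.2‖) (fun x => norm_nonneg _) _
  have hsum : (fun i => ∑ j, ((‖y i j‖ ^ p.toReal : ℝ) : ℂ)) =
      fun i => ((∑ j, ‖y i j‖ ^ p.toReal : ℝ) : ℂ) := by
    funext i; push_cast; rfl
  rw [tracePQ, habs, hpow, partialTrace₂_prodConjDiag, hsum,
    conjDiag_rpow _ _ (fun i => by positivity), trace_conjDiag, ← Complex.ofReal_sum,
    Complex.ofReal_re, mixedNorm_eq hp hq, lpn_of_ne_top hq hq']
  congr 1
  refine Finset.sum_congr rfl fun i _ => ?_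
  rw [abs_of_nonneg (lpn_nonneg hp _), lpn_of_ne_top hp hp', ← Real.rpow_mul (by positivity)]
  simp only [abs_norm]
  congr 1
  ring

/-- The unitary matrix whose columns are the vectors of an orthonormal basis. -/
noncomputable def basisUnitary (e : OrthonormalBasis (Fin n) ℂ (EuclideanSpace ℂ (Fin n))) :
    Matrix.unitaryGroup (Fin n) ℂ :=
  ⟨Matrix.of fun k i => e i k, by
    rw [Matrix.mem_unitaryGroup_iff']
    ext i j
    have := (orthonormal_iff_ite.1 e.orthonormal) i j
    rw [PiLp.inner_apply] at this
    rw [Matrix.mul_apply, Matrix.one_apply, ← this]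
    refine Finset.sum_congr rfl fun k _ => ?_
    simp [Matrix.star_apply, mul_comm]⟩

lemma IsDiagIn.eq_prodConjDiag {e : OrthonormalBasis (Fin n) ℂ (EuclideanSpace ℂ (Fin n))}
    {f : OrthonormalBasis (Fin m) ℂ (EuclideanSpace ℂ (Fin m))}
    {Y : Matrix (Fin n × Fin m) (Fin n × Fin m) ℂ} {y : Fin n → Fin m → ℂ}
    (h : IsDiagIn e f Y y) : Y = prodConjDiag (basisUnitary e) (basisUnitary f) y := by
  rw [prodConjDiag, conjDiag_apply]
  set U : Matrix.unitaryGroup (Fin n × Fin m) ℂ :=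
    ⟨_, kronecker_mem_unitaryGroup (basisUnitary e) (basisUnitary f)⟩ with hU
  have hYU : Y * (U : Matrix (Fin n × Fin m) (Fin n × Fin m) ℂ) =
      (U : Matrix (Fin n × Fin m) (Fin n × Fin m) ℂ) *
        Matrix.diagonal (fun x : Fin n × Fin m => y x.1 x.2) := by
    ext x ⟨i, j⟩
    rw [Matrix.mul_diagonal]
    have := congrFun (h i j) x
    rw [Pi.smul_apply, smul_eq_mul] at this
    rw [mul_comm]
    exact this
  rw [← hYU, mul_assoc, Unitary.mul_star_self_of_mem U.2, mul_one]

end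

end NCNorm

theorem lemma1 (n m : ℕ) (p q : ℝ≥0∞) (hp : 1 ≤ p) (hq : 1 ≤ q) :
    -- the defining supremum is finite, and the defining infimum is over a non-empty set
    (∀ Y : Matrix (Fin n × Fin m) (Fin n × Fin m) ℂ,
      (p ≤ q → BddAbove (NCNorm.supSet p q Y)) ∧ (q ≤ p → (NCNorm.infSet p q Y).Nonempty)) ∧
    -- (a) triangle inequality
    (∀ Y W : Matrix (Fin n × Fin m) (Fin n × Fin m) ℂ,
      NCNorm.ncNorm p q (Y + W) ≤ NCNorm.ncNorm p q Y + NCNorm.ncNorm p q W) ∧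
    -- (b) Hölder's inequality
    (∀ p' q' : ℝ≥0∞, p'⁻¹ = 1 - p⁻¹ → q'⁻¹ = 1 - q⁻¹ →
      ∀ Y W : Matrix (Fin n × Fin m) (Fin n × Fin m) ℂ,
        ‖Matrix.trace (Y * W)‖ ≤ NCNorm.ncNorm p q Y * NCNorm.ncNorm p' q' W) ∧
    -- (c) duality
    (∀ p' q' : ℝ≥0∞, p'⁻¹ = 1 - p⁻¹ → q'⁻¹ = 1 - q⁻¹ →
      ∀ Y : Matrix (Fin n × Fin m) (Fin n × Fin m) ℂ,
        IsLUB {x : ℝ | ∃ W : Matrix (Fin n × Fin m) (Fin n × Fin m) ℂ,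
          NCNorm.ncNorm p' q' W ≤ 1 ∧ x = ‖Matrix.trace (Y * W)‖} (NCNorm.ncNorm p q Y)) ∧
    -- (d) product matrices
    (∀ (Y₁ : Matrix (Fin n) (Fin n) ℂ) (Y₂ : Matrix (Fin m) (Fin m) ℂ),
      NCNorm.ncNorm p q (Y₁ ⊗ₖ Y₂) = NCNorm.schatten q Y₁ * NCNorm.schatten p Y₂) ∧
    -- (e) at `p = q` both defining expressions reduce to the Schatten norm
    (p = q → ∀ Y : Matrix (Fin n × Fin m) (Fin n × Fin m) ℂ,
      NCNorm.ncNorm p q Y = NCNorm.schatten p Y ∧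
      NCNorm.ncSup p q Y = NCNorm.schatten p Y ∧ NCNorm.ncInf p q Y = NCNorm.schatten p Y) ∧
    -- (f) matrices that are diagonal in a product basis
    (∀ (e : OrthonormalBasis (Fin n) ℂ (EuclideanSpace ℂ (Fin n)))
      (f : OrthonormalBasis (Fin m) ℂ (EuclideanSpace ℂ (Fin m)))
      (Y : Matrix (Fin n × Fin m) (Fin n × Fin m) ℂ) (y : Fin n → Fin m → ℂ),
      NCNorm.IsDiagIn e f Y y →
        (p ≠ ∞ → q ≠ ∞ → NCNorm.ncNorm p q Y = NCNorm.tracePQ p.toReal q.toReal Y) ∧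
        NCNorm.ncNorm p q Y = NCNorm.mixedNorm p q y) := by
  have conj : ∀ {s s' : ℝ≥0∞}, 1 ≤ s → s'⁻¹ = 1 - s⁻¹ → s⁻¹ + s'⁻¹ = 1 := fun {s s'} hs h => by
    rw [h]; exact add_tsub_cancel_of_le (ENNReal.inv_le_one.2 hs)
  refine ⟨fun Y => ⟨fun _ => NCNorm.bddAbove_supSet hp hq Y, fun _ => NCNorm.infSet_nonempty p q Y⟩,
    NCNorm.ncNorm_add_le hp hq,
    fun p' q' hp' hq' => NCNorm.norm_trace_mul_le_ncNorm hp hq (conj hp hp') (conj hq hq'),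
    fun p' q' hp' hq' => NCNorm.isLUB_ncNorm hp hq (conj hp hp') (conj hq hq'),
    NCNorm.ncNorm_kronecker hp hq, ?_, fun e f Y y h => ?_⟩
  · rintro rfl Y
    exact ⟨NCNorm.ncNorm_self hp Y, NCNorm.ncSup_self hp Y, NCNorm.ncInf_self hp Y⟩
  · rw [h.eq_prodConjDiag, NCNorm.ncNorm_prodConjDiag hp hq]
    exact ⟨fun hp' hq' => (NCNorm.tracePQ_prodConjDiag hp hq hp' hq' _ _ y).symm, rfl⟩
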